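/- Let $(X,\mathcal D)$ be a nonempty metric space. An instance of the Lipschitz experts problem on $X$ is a Borel probability measure $\mathbb P$ on $[0,1]^X$ (with the product topology) such that $\mu(x)=\mathbb E_{f\sim\mathbb P}[f(x)]$ satisfies $|\mu(x)-\mu(y)|\le \mathcal D(x,y)$ for all $x,y\in X$. The instance is unknown to the algorithm. In each round $t$ the algorithm picks a strategy $x_t\in X$, a fresh independent payoff function $f_t\sim\mathbb P$ is drawn, and the algorithm receives the payoff $f_t(x_t)$. In the bandit setting it observes only $f_t(x_t)$; with full feedback it may moreover query, adaptively, the values of $f_t$ at further points (any finite number, or even a sequence of points). An algorithm is a randomized Borel-measurable decision rule, mapping a random seed and the history of past observations to the next point. Its regret on $\mathbb P$ is $$R(t)=t\,\sup_{x\in X}\mu(x)-\mathbb E\Big[\sum_{s=1}^t\mu(x_s)\Big].$$ For $f:\mathbb N\to\mathbb R$, the problem is $f(t)$-tractable (in the bandit setting, or with full feedback) if there is an algorithm for that setting such that for every instance $\mathbb P$ there is a constant $C_{\mathbb P}$ with $R(t)\le C_{\mathbb P}\,f(t)$ for all $t$. For tractability in the bandit setting, the strategies $x_t$ of the algorithm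 must be measurable random variables (so that $R$ is defined) on every instance; with full feedback, the bound is required only on those instances on which they are. Then exactly one of the following holds: 1. the problem on $(X,\mathcal D)$ is $f(t)$-tractable in the bandit setting for some $f\in o(t)$; 2. for every $g\in o(t)$, the problem on $(X,\mathcal D)$ is not $g(t)$-tractable, even with full feedback. Moreover, the first case holds if and only if the metric completion of $(X,\mathcal D)$ is compact. -/

import Mathlib

open MeasureTheory Filter Asymptotics

universe u

/-- The space `[0,1]^X` of all payoff functions on the set of strategies `X`, with the product
topology and the Borel sigma-algebra of that topology. -/
def Payoff (X : Type u) : Type u := X → unitInterval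

instance (X : Type u) : TopologicalSpace (Payoff X) :=
  inferInstanceAs (TopologicalSpace (X → unitInterval))

instance (X : Type u) : MeasurableSpace (Payoff X) := borel (Payoff X)

instance (X : Type u) : BorelSpace (Payoff X) := ⟨rfl⟩

/-- The expected payoff function `μ(x) = E_{f ∼ P} [f(x)]`. -/
noncomputable def meanPayoff {X : Type u} (P : Measure (Payoff X)) (x : X) : ℝ :=
  ∫ f : Payoff X, (f x : ℝ) ∂P

/-- `P` is an instance of the Lipschitz experts problem on `X`: a probability measure on payoff
functions whose expected payoff function is Lipschitz with constant `1`. -/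
structure IsLipschitzInstance {X : Type u} [MetricSpace X] (P : Measure (Payoff X)) : Prop where
  isProbabilityMeasure : IsProbabilityMeasure P
  lipschitz : LipschitzWith 1 (meanPayoff P)

/-- A (possibly randomized) algorithm for the experts problem, as an abstract decision rule.

It has a random seed, drawn once from a probability space. In round `t` (rounds are numbered from
`0`) it chooses points `y₀, y₁, y₂, …` of `X` one after the other and observes the values
`f_t(y₀), f_t(y₁), …` of the payoff function `f_t` of that round. The point `y₀` is the strategy
played in the round, with payoff `f_t(y₀)`; the points `y₁, y₂, …` are additional queries to `f_t`.
The point `y_n = point t n (seed, h, a)` is a measurable function of the seed, of the values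
`h s m` (`s < t`) observed in the earlier rounds, and of the values `a m` (`m < n`) observed so far
in the current round. (To query only finitely many points, repeat a point.) -/
structure ExpertsAlgorithm (X : Type u) [MeasurableSpace X] where
  Seed : Type u
  [measurableSpaceSeed : MeasurableSpace Seed]
  seedLaw : Measure Seed
  [isProbabilityMeasure_seedLaw : IsProbabilityMeasure seedLaw]
  point (t n : ℕ) : Seed × (Fin t → ℕ → unitInterval) × (Fin n → unitInterval) → X
  measurable_point (t n : ℕ) : Measurable (point t n)

namespace ExpertsAlgorithm

attribute [instance] measurableSpaceSeed isProbabilityMeasure_seedLaw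

variable {X : Type u} [MeasurableSpace X] (A : ExpertsAlgorithm X)

/-- The first `n` values observed in round `t`, given the seed `ω`, the observations `h` of the
earlier rounds, and the payoff function `f` of round `t`. -/
def answers (ω : A.Seed) (t : ℕ) (h : Fin t → ℕ → unitInterval) (f : Payoff X) :
    (n : ℕ) → Fin n → unitInterval
  | 0 => Fin.elim0
  | n + 1 => Fin.snoc (α := fun _ => unitInterval) (answers ω t h f n)
      (f (A.point t n (ω, h, answers ω t h f n)))

/-- All values observed in the first `t` rounds, given the seed `ω` and the payoff functions
`f 0, f 1, …`. -/
def history (ω : A.Seed) (f : ℕ → Payoff X) : (t : ℕ) → Fin t → ℕ → unitInterval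
  | 0 => Fin.elim0
  | t + 1 => Fin.snoc (α := fun _ => ℕ → unitInterval) (history ω f t)
      (fun n => f t (A.point t n (ω, history ω f t, A.answers ω t (history ω f t) (f t) n)))

/-- The strategy played in round `t`, as a function of the seed and of the payoff functions. -/
def strategy (t : ℕ) (z : A.Seed × (ℕ → Payoff X)) : X :=
  A.point t 0 (z.1, A.history z.1 z.2 t, Fin.elim0)

/-- The joint law of the seed and of the payoff functions `f_0, f_1, …`: the latter are independent
samples from `P`, and independent of the seed. -/
noncomputable def sampleLaw (P : Measure (Payoff X)) :
    Measure (A.Seed × (ℕ → Payoff X)) :=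
  A.seedLaw.prod (Measure.infinitePi (fun _ : ℕ => P))

/-- The strategies played on instance `P` are random variables, so that the regret is defined. -/
def WellDefinedOn (P : Measure (Payoff X)) : Prop :=
  ∀ t : ℕ, AEMeasurable (A.strategy t) (A.sampleLaw P)

/-- The regret after `t` rounds, `R(t) = t · sup μ - E[μ(x_0) + … + μ(x_{t-1})]`. -/
noncomputable def regret (P : Measure (Payoff X)) (t : ℕ) : ℝ :=
  t * (⨆ x, meanPayoff P x) -
    ∫ z, ∑ s ∈ Finset.range t, meanPayoff P (A.strategy s z) ∂(A.sampleLaw P)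

/-- `A` works in the bandit setting: the strategy played depends only on the seed and on the payoffs
received in the earlier rounds. -/
def UsesBanditFeedback : Prop :=
  ∀ (t : ℕ) (ω : A.Seed) (h h' : Fin t → ℕ → unitInterval) (a : Fin 0 → unitInterval),
    (∀ s, h s 0 = h' s 0) → A.point t 0 (ω, h, a) = A.point t 0 (ω, h', a)

end ExpertsAlgorithm

/-- The Lipschitz experts problem on `X` is `f(t)`-tractable in the bandit setting: some bandit
algorithm is well defined and has regret `R(t) ≤ C_P f(t)` on every problem instance `P`. -/
def BanditTractable (X : Type u) [MetricSpace X] [MeasurableSpace X] (f : ℕ → ℝ) : Prop :=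
  ∃ A : ExpertsAlgorithm X, A.UsesBanditFeedback ∧
    ∀ P : Measure (Payoff X), IsLipschitzInstance P →
      A.WellDefinedOn P ∧ ∃ C : ℝ, ∀ t : ℕ, A.regret P t ≤ C * f t

/-- The Lipschitz experts problem on `X` is `f(t)`-tractable with full feedback. The regret bound is
required only for the instances on which the regret of the algorithm is well defined: when `X` is
uncountable, a measurable decision rule that may visit uncountably many points can give
non-measurable strategies on pathological measures `P`. Thus intractability means that every
measurable decision rule violates the bound on an instance on which its regret is well defined. -/
def FullFeedbackTractable (X : Type u) [MetricSpace X] [MeasurableSpace X] (f : ℕ → ℝ) : Prop :=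
  ∃ A : ExpertsAlgorithm X,
    ∀ P : Measure (Payoff X), IsLipschitzInstance P → A.WellDefinedOn P →
      ∃ C : ℝ, ∀ t : ℕ, A.regret P t ≤ C * f t

/-! The dividing line is total boundedness of `X`, which amounts to compactness of the completion
(`compactSpace_completion_iff`).

If `X` is totally bounded, it has finite nets at every scale. An explore-exploit rule samples their
points on a fixed sparse schedule and otherwise plays the empirically best point of a net, refined
so slowly that eventually enough samples are always available. The expected gap in these rounds
tends to 0 at a rate that does not depend on the instance (`integral_gap_exploit_le`), so the regret
is o(t).

If `X` is not totally bounded, it contains infinitely many uniformly separated points, indexed by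
pairs (k, i). A random payoff is a sum of disjoint bumps at these points, switched on by fair coins
and scaled by weights increasing in k, except that in each row k the coin at (k, θ k) always shows
heads. Playing anything but a planted bump of a row beyond k loses at least some δ k > 0 per round.
Even seeing all coins hardly helps: s rounds of constant heads at a given place have probability 2⁻ˢ
under fair coins, so planting there raises the probability of any event by at most 2ˢ
(`lintegral_hit_plant_le`). If θ k is uniform on a set exponentially large in the horizon T k,
averaging gives one θ that hides all rows at once (`exists_plant_avoid`). The resulting single
instance defeats every constant C, because the horizons are chosen with k |g (T k)| < δ k T k / 2.
-/

open ProbabilityTheory Topology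
open scoped ENNReal

/-! ### Resampling and fixing coordinates of product measures -/

section InfinitePi

variable {ι : Type*} {Ω : ι → Type*} {mΩ : ∀ i, MeasurableSpace (Ω i)} [DecidableEq ι]

/-- Resampling one coordinate does not change a product measure. -/
theorem infinitePi_map_update (μ : ∀ i, Measure (Ω i)) [∀ i, IsProbabilityMeasure (μ i)] (i : ι) :
    ((Measure.infinitePi μ).prod (μ i)).map (fun p => Function.update p.1 i p.2) =
      Measure.infinitePi μ := by
  refine Measure.eq_infinitePi μ fun s t ht => ?_
  rw [Measure.map_apply measurable_update' (MeasurableSet.pi s.countable_toSet fun j _ => ht j)]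
  have hpre : (fun p : (∀ j, Ω j) × Ω i => Function.update p.1 i p.2) ⁻¹' ((s : Set ι).pi t) =
      (((s.erase i : Finset ι) : Set ι).pi t) ×ˢ {y | i ∈ s → y ∈ t i} := by
    ext ⟨a, y⟩
    simp only [Set.mem_preimage, Set.mem_pi, Set.mem_prod, Finset.mem_coe, Finset.mem_erase,
      Set.mem_ofPred_eq]
    constructor
    · intro h
      exact ⟨fun j hj => by simpa [hj.1] using h j hj.2, fun hi => by simpa using h i hi⟩
    · rintro ⟨h1, h2⟩ j hj
      by_cases hji : j = i
      · subst hji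
        simpa using h2 hj
      · simpa [hji] using h1 j ⟨hji, hj⟩
  rw [hpre, Measure.prod_prod, Measure.infinitePi_pi μ (fun j _ => ht j)]
  by_cases hi : i ∈ s
  · have : {y | i ∈ s → y ∈ t i} = t i := by ext; simp [hi]
    rw [this, Finset.prod_erase_mul s (fun j => μ j (t j)) hi]
  · have : {y | i ∈ s → y ∈ t i} = Set.univ := by ext; simp [hi]
    rw [this, measure_univ, mul_one, Finset.erase_eq_of_notMem hi]

theorem lintegral_infinitePi_update (μ : ∀ i, Measure (Ω i)) [∀ i, IsProbabilityMeasure (μ i)]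
    (i : ι) {F : (∀ i, Ω i) → ℝ≥0∞} (hF : Measurable F) :
    ∫⁻ u, ∫⁻ y, F (Function.update u i y) ∂(μ i) ∂(Measure.infinitePi μ) =
      ∫⁻ u, F u ∂(Measure.infinitePi μ) := by
  conv_rhs => rw [← infinitePi_map_update μ i]
  rw [lintegral_map hF measurable_update']
  exact (lintegral_prod _ (hF.comp measurable_update').aemeasurable).symm

/-- Fixing one coordinate of a product measure at an atom of mass `c` costs a factor `1 / c`. -/
theorem lintegral_update_atom_le (μ : ∀ i, Measure (Ω i)) [∀ i, IsProbabilityMeasure (μ i)]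
    (i : ι) [MeasurableSingletonClass (Ω i)] (y : Ω i)
    {F : (∀ i, Ω i) → ℝ≥0∞} (hF : Measurable F) :
    μ i {y} * ∫⁻ u, F (Function.update u i y) ∂(Measure.infinitePi μ) ≤
      ∫⁻ u, F u ∂(Measure.infinitePi μ) := by
  rw [← lintegral_infinitePi_update μ i hF,
    ← lintegral_const_mul (f := fun u => F (Function.update u i y)) _
      (hF.comp measurable_update_left)]
  refine lintegral_mono fun u => ?_
  calc μ i {y} * F (Function.update u i y)
      = ∫⁻ z in {y}, F (Function.update u i z) ∂(μ i) := by
        rw [lintegral_singleton, mul_comm]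
    _ ≤ _ := setLIntegral_le_lintegral _ _

end InfinitePi

/-! ### Fair coins and the cost of forcing heads -/

/-- A fair coin. -/
noncomputable def coin : Measure Bool := (2⁻¹ : ℝ≥0∞) • (Measure.dirac true + Measure.dirac false)

instance : IsProbabilityMeasure coin := ⟨by
  simp only [coin, Measure.smul_apply, Measure.add_apply, measure_univ, smul_eq_mul]
  rw [one_add_one_eq_two]
  exact ENNReal.inv_mul_cancel (by simp) (by simp)⟩

theorem coin_singleton (b : Bool) : coin {b} = 2⁻¹ := by
  cases b <;> simp [coin]

theorem integral_coin (g : Bool → ℝ) : ∫ b, g b ∂coin = (g true + g false) / 2 := by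
  rw [coin, integral_smul_measure, integral_add_measure, integral_dirac, integral_dirac]
  · simp; ring
  · exact Integrable.of_finite
  · exact Integrable.of_finite

/-- Independent fair coins indexed by `ι`. -/
noncomputable abbrev coins (ι : Type*) : Measure (ι → Bool) := Measure.infinitePi fun _ => coin

/-- The array of coins `u`, with the coins at `a` in the rounds before `n` set to heads. -/
def setHeads {ι : Type*} [DecidableEq ι] (a : ι) (n : ℕ) (v : ℕ → ι → Bool) : ℕ → ι → Bool :=
  fun s i => if s < n ∧ i = a then true else v s i

theorem measurable_setHeads {ι : Type*} [DecidableEq ι] (a : ι) (n : ℕ) :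
    Measurable (setHeads a n) := by
  refine measurable_pi_lambda _ fun s => measurable_pi_lambda _ fun i => ?_
  by_cases h : s < n ∧ i = a
  · simp [setHeads, h]
  · simp only [setHeads, h, if_false]
    fun_prop

/-- Setting one coin per round to heads during `n` rounds costs a factor `2 ^ n`. -/
theorem lintegral_setHeads_le {ι : Type*} [DecidableEq ι] (a : ι) (n : ℕ)
    {F : (ℕ → ι → Bool) → ℝ≥0∞} (hF : Measurable F) :
    ∫⁻ v, F (setHeads a n v) ∂(Measure.infinitePi fun _ : ℕ => coins ι) ≤
      2 ^ n * ∫⁻ v, F v ∂(Measure.infinitePi fun _ : ℕ => coins ι) := by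
  induction n with
  | zero =>
    have : ∀ v : ℕ → ι → Bool, setHeads a 0 v = v := fun v => by funext; simp [setHeads]
    simp [this]
  | succ n ih =>
    set M := Measure.infinitePi fun _ : ℕ => coins ι
    set G : (ℕ → ι → Bool) → ℝ≥0∞ := fun v => F (setHeads a n v) with hGdef
    have hG : Measurable G := hF.comp (measurable_setHeads a n)
    have key : ∀ v, F (setHeads a (n + 1) v) =
        G (Function.update v n (Function.update (v n) a true)) := by
      intro v
      simp only [hGdef]
      congr 1
      funext s i
      simp only [setHeads]
      rcases lt_trichotomy s n with h | h | h
      · have : s ≠ n := h.ne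
        by_cases hi : i = a
        · simp [h, hi, h.trans (Nat.lt_succ_self n)]
        · simp [hi, this]
      · subst h
        by_cases hi : i = a
        · simp [hi]
        · simp [hi]
      · have h1 : s ≠ n := h.ne'
        have h2 : ¬ s < n := by omega
        have h3 : ¬ s < n + 1 := by omega
        simp [h1, h2, h3]
    have step : (2⁻¹ : ℝ≥0∞) * ∫⁻ v, F (setHeads a (n + 1) v) ∂M ≤ ∫⁻ v, G v ∂M := by
      have hm : Measurable fun v : ℕ → ι → Bool =>
          G (Function.update v n (Function.update (v n) a true)) := by
        simp_rw [← key]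
        exact hF.comp (measurable_setHeads a (n + 1))
      simp_rw [key]
      -- Resampling round `n` on both sides freezes the other rounds, and the one-coin estimate
      -- applies to the coins of round `n` alone.
      rw [← lintegral_infinitePi_update (fun _ : ℕ => coins ι) n hm,
        ← lintegral_infinitePi_update (fun _ : ℕ => coins ι) n hG, ← lintegral_const_mul]
      · refine lintegral_mono fun v => ?_
        simp only [Function.update_self, Function.update_idem]
        rw [← coin_singleton true]
        exact lintegral_update_atom_le (fun _ : ι => coin) a true
          (F := fun w => G (Function.update v n w)) (hG.comp (measurable_update v))
      · exact (hm.comp measurable_update').lintegral_prod_right'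
    calc ∫⁻ v, F (setHeads a (n + 1) v) ∂M
        = 2 * ((2⁻¹ : ℝ≥0∞) * ∫⁻ v, F (setHeads a (n + 1) v) ∂M) := by
          rw [← mul_assoc, ENNReal.mul_inv_cancel (by simp) (by simp), one_mul]
      _ ≤ 2 * ∫⁻ v, G v ∂M := by gcongr
      _ ≤ 2 * (2 ^ n * ∫⁻ v, F v ∂M) := by gcongr
      _ = _ := by rw [pow_succ' (2 : ℝ≥0∞) n, mul_assoc]

/-- There are probability measures on `ℕ` with arbitrarily small atoms. -/
theorem exists_isProbabilityMeasure_singleton_le (N : ℕ) :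
    ∃ l : Measure ℕ, IsProbabilityMeasure l ∧ ∀ i, l {i} ≤ (2⁻¹ : ℝ≥0∞) ^ N := by
  refine ⟨uniformOn (Finset.range (2 ^ N) : Set ℕ), isProbabilityMeasure_uniformOn
    (Finset.finite_toSet _) ⟨0, by simp⟩, fun i => ?_⟩
  rw [uniformOn, cond_apply (Finset.measurableSet _), Measure.count_apply_finset]
  calc _ ≤ (((Finset.range (2 ^ N)).card : ℕ) : ℝ≥0∞)⁻¹ * Measure.count {i} := by
        gcongr; exact Set.inter_subset_right
    _ = _ := by simp [ENNReal.inv_pow]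

/-! ### Planted coins stay hidden -/

/-- The coins `v`, with the coin at `(k, θ k)` replaced by heads for every `k`. -/
def plant (θ : ℕ → ℕ) (v : ℕ × ℕ → Bool) : ℕ × ℕ → Bool :=
  fun a => decide (a.2 = θ a.1) || v a

/-- As `plant`, but leaving the coins in row `k` alone. -/
def plantOff (k : ℕ) (θ : ℕ → ℕ) (v : ℕ × ℕ → Bool) : ℕ × ℕ → Bool :=
  fun a => decide (a.1 ≠ k ∧ a.2 = θ a.1) || v a

theorem measurable_plant :
    Measurable fun p : (ℕ → ℕ) × (ℕ × ℕ → Bool) => plant p.1 p.2 := by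
  refine measurable_pi_lambda _ fun a => ?_
  have h : Measurable fun q : ℕ × Bool => decide (a.2 = q.1) || q.2 := Measurable.of_discrete
  exact h.comp (f := fun p : (ℕ → ℕ) × (ℕ × ℕ → Bool) => (p.1 a.1, p.2 a)) (by fun_prop)

theorem measurable_plantOff (k : ℕ) (θ : ℕ → ℕ) : Measurable (plantOff k θ) := by
  refine measurable_pi_lambda _ fun a => ?_
  have h : Measurable fun q : Bool => decide (a.1 ≠ k ∧ a.2 = θ a.1) || q := Measurable.of_discrete
  exact h.comp (measurable_pi_apply a)

/-- This moves the whole dependence on the planted position `i` of row `k` into `setHeads`, whose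
cost is known; what remains does not involve `i`. -/
theorem plant_update (k i : ℕ) (θ : ℕ → ℕ) (s n : ℕ) (hn : n < s) (v : ℕ → ℕ × ℕ → Bool) :
    plant (Function.update θ k i) (v n) = plantOff k θ (setHeads (k, i) s v n) := by
  funext ⟨j, l⟩
  by_cases hj : j = k
  · subst hj
    by_cases hl : l = i <;> simp [plant, plantOff, setHeads, hn, hl]
  · simp [plant, plantOff, setHeads, hj]

/-- A decision based on `s` rounds of coins hits the planted coin of row `k` with small
probability. -/
theorem lintegral_hit_plant_le {S : Type*} [MeasurableSpace S] (σ : Measure S)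
    [IsProbabilityMeasure σ] (l : ℕ → Measure ℕ) [∀ k, IsProbabilityMeasure (l k)]
    (K : S × (ℕ → ℕ × ℕ → Bool) → ℕ × ℕ) (hK : Measurable K) (s : ℕ)
    (hloc : ∀ ω v v', (∀ n < s, v n = v' n) → K (ω, v) = K (ω, v')) (k : ℕ) (ε : ℝ≥0∞)
    (hl : ∀ i, l k {i} ≤ ε) :
    ∫⁻ θ, (σ.prod (Measure.infinitePi fun _ : ℕ => coins (ℕ × ℕ)))
        {z | K (z.1, fun n => plant θ (z.2 n)) = (k, θ k)} ∂(Measure.infinitePi l) ≤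
      2 ^ s * ε := by
  set C := Measure.infinitePi fun _ : ℕ => coins (ℕ × ℕ)
  set M := σ.prod C
  have hSmeas : MeasurableSet {q : (ℕ → ℕ) × (S × (ℕ → ℕ × ℕ → Bool)) |
      K (q.2.1, fun n => plant q.1 (q.2.2 n)) = (k, q.1 k)} := by
    refine measurableSet_eq_fun ?_ ?_
    · refine hK.comp ((measurable_fst.comp measurable_snd).prodMk
        (measurable_pi_lambda _ fun n => ?_))
      exact measurable_plant.comp (f := fun q : (ℕ → ℕ) × (S × (ℕ → ℕ × ℕ → Bool)) =>
        (q.1, q.2.2 n)) (by fun_prop)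
    · fun_prop
  have hH : Measurable fun θ : ℕ → ℕ => M {z | K (z.1, fun n => plant θ (z.2 n)) = (k, θ k)} :=
    measurable_measure_prodMk_left hSmeas
  -- It suffices to average over the entry `θ k` with the rest of `θ` fixed.
  rw [← lintegral_infinitePi_update l k hH]
  have key : ∀ θ : ℕ → ℕ, ∫⁻ i, M {z | K (z.1, fun n => plant (Function.update θ k i) (z.2 n)) =
      (k, Function.update θ k i k)} ∂(l k) ≤ 2 ^ s * ε := by
    intro θ
    -- The decision when row `k` has no planted coin; it is independent of the random position `i`.
    set K' : S × (ℕ → ℕ × ℕ → Bool) → ℕ × ℕ := fun z => K (z.1, fun n => plantOff k θ (z.2 n))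
      with hK'
    have hK'm : Measurable K' := by
      refine hK.comp (measurable_fst.prodMk (measurable_pi_lambda _ fun n => ?_))
      exact (measurable_plantOff k θ).comp (by fun_prop)
    have hbd : ∀ i, M {z | K (z.1, fun n => plant (Function.update θ k i) (z.2 n)) =
        (k, Function.update θ k i k)} ≤ 2 ^ s * M (K' ⁻¹' {(k, i)}) := by
      intro i
      have hE : {z : S × (ℕ → ℕ × ℕ → Bool) |
          K (z.1, fun n => plant (Function.update θ k i) (z.2 n)) =
            (k, Function.update θ k i k)} =
          (fun z : S × (ℕ → ℕ × ℕ → Bool) => (z.1, setHeads (k, i) s z.2)) ⁻¹'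
            (K' ⁻¹' {(k, i)}) := by
        ext z
        simp only [Function.update_self, Set.mem_ofPred_eq, Set.mem_preimage,
          Set.mem_singleton_iff, hK']
        rw [hloc z.1 _ _ fun n hn => plant_update k i θ s n hn z.2]
      have hm : MeasurableSet (K' ⁻¹' {(k, i)}) := hK'm (measurableSet_singleton _)
      have hg : Measurable fun z : S × (ℕ → ℕ × ℕ → Bool) => (z.1, setHeads (k, i) s z.2) :=
        measurable_fst.prodMk ((measurable_setHeads _ _).comp measurable_snd)
      rw [hE, Measure.prod_apply (hg hm), Measure.prod_apply hm,
        ← lintegral_const_mul _ (measurable_measure_prodMk_left hm)]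
      refine lintegral_mono fun ω => ?_
      have hm' : MeasurableSet (Prod.mk ω ⁻¹' (K' ⁻¹' {(k, i)})) := measurable_prodMk_left hm
      have := lintegral_setHeads_le (k, i) s (F := (Prod.mk ω ⁻¹' (K' ⁻¹' {(k, i)})).indicator 1)
        (measurable_one.indicator hm')
      rw [lintegral_indicator_one hm'] at this
      rw [← lintegral_indicator_one (measurable_prodMk_left (hg hm))]
      exact this
    calc _ ≤ ∫⁻ i, 2 ^ s * M (K' ⁻¹' {(k, i)}) ∂(l k) := lintegral_mono hbd
      _ = 2 ^ s * ∫⁻ i, M (K' ⁻¹' {(k, i)}) ∂(l k) := lintegral_const_mul _ Measurable.of_discrete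
      _ ≤ 2 ^ s * ε := by
        gcongr
        have hm : MeasurableSet {q : ℕ × (S × (ℕ → ℕ × ℕ → Bool)) | K' q.2 = (k, q.1)} := by
          refine measurableSet_eq_fun (hK'm.comp measurable_snd) (by fun_prop)
        have e1 : ∫⁻ i, M (K' ⁻¹' {(k, i)}) ∂(l k) =
            ((l k).prod M) {q | K' q.2 = (k, q.1)} := (Measure.prod_apply hm).symm
        -- After exchanging the integrals, each outcome of `K'` matches at most one `i`, which has
        -- mass at most `ε`.
        rw [e1, Measure.prod_apply_symm hm]
        calc _ ≤ ∫⁻ _ : S × (ℕ → ℕ × ℕ → Bool), ε ∂M := by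
              refine lintegral_mono fun z => (measure_mono ?_).trans (hl (K' z).2)
              intro i (hi : K' z = (k, i))
              simp [hi]
          _ = ε := by simp
  calc _ ≤ ∫⁻ _ : ℕ → ℕ, 2 ^ s * ε ∂(Measure.infinitePi l) := lintegral_mono key
    _ = _ := by simp

/-- For any decision rules and time horizons there is a choice of planted coins that the rules
hardly ever hit. -/
theorem exists_plant_avoid {S : Type*} [MeasurableSpace S] (σ : Measure S)
    [IsProbabilityMeasure σ] (K : ℕ → S × (ℕ → ℕ × ℕ → Bool) → ℕ × ℕ) (hK : ∀ s, Measurable (K s))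
    (hloc : ∀ s ω v v', (∀ n < s, v n = v' n) → K s (ω, v) = K s (ω, v')) (T : ℕ → ℕ) :
    ∃ θ : ℕ → ℕ, ∑' k, ∑ s ∈ Finset.range (T k),
      (σ.prod (Measure.infinitePi fun _ : ℕ => coins (ℕ × ℕ)))
        {z | K s (z.1, fun n => plant θ (z.2 n)) = (k, θ k)} ≤ 2⁻¹ := by
  -- One `T k` pays for the factor `2 ^ s`, the other for the union over `T k` rounds; the factors
  -- `2⁻¹ ^ (k + 2)` left over sum to `2⁻¹`.
  choose l hlp hl using fun k => exists_isProbabilityMeasure_singleton_le (T k + T k + (k + 2))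
  set M := σ.prod (Measure.infinitePi fun _ : ℕ => coins (ℕ × ℕ))
  have hmeas : ∀ k s, Measurable fun θ : ℕ → ℕ =>
      M {z | K s (z.1, fun n => plant θ (z.2 n)) = (k, θ k)} := by
    intro k s
    refine measurable_measure_prodMk_left (s := {q : (ℕ → ℕ) × (S × (ℕ → ℕ × ℕ → Bool)) |
      K s (q.2.1, fun n => plant q.1 (q.2.2 n)) = (k, q.1 k)}) ?_
    refine measurableSet_eq_fun ?_ (by fun_prop)
    refine (hK s).comp ((measurable_fst.comp measurable_snd).prodMk
      (measurable_pi_lambda _ fun n => ?_))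
    exact measurable_plant.comp (f := fun q : (ℕ → ℕ) × (S × (ℕ → ℕ × ℕ → Bool)) =>
      (q.1, q.2.2 n)) (by fun_prop)
  -- First-moment method: some `θ` does no worse than the average.
  obtain ⟨θ, hθ⟩ := exists_le_lintegral (μ := Measure.infinitePi l)
    (f := fun θ => ∑' k, ∑ s ∈ Finset.range (T k),
      M {z | K s (z.1, fun n => plant θ (z.2 n)) = (k, θ k)})
    (Measurable.tsum fun k => Finset.measurable_fun_sum _ fun s _ => hmeas k s).aemeasurable
  refine ⟨θ, hθ.trans ?_⟩
  rw [lintegral_tsum fun k =>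
    (Finset.measurable_fun_sum _ fun s _ => hmeas k s).aemeasurable]
  have hpow : ∀ n : ℕ, (2 : ℝ≥0∞) ^ n * 2⁻¹ ^ n = 1 := fun n => by
    rw [← mul_pow, ENNReal.mul_inv_cancel (by simp) (by simp), one_pow]
  calc _ ≤ ∑' k : ℕ, (2⁻¹ : ℝ≥0∞) ^ (k + 2) := by
        refine ENNReal.tsum_le_tsum fun k => ?_
        rw [lintegral_finsetSum _ fun s _ => hmeas k s]
        calc _ ≤ ∑ s ∈ Finset.range (T k),
              (2 : ℝ≥0∞) ^ T k * 2⁻¹ ^ (T k + T k + (k + 2)) := by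
              refine Finset.sum_le_sum fun s hs => ?_
              refine (lintegral_hit_plant_le σ l (K s) (hK s) s (hloc s) k _ (hl k)).trans ?_
              gcongr
              · exact one_le_two
              · exact (Finset.mem_range.1 hs).le
          _ = (T k : ℝ≥0∞) * (2⁻¹ ^ T k * 2⁻¹ ^ (k + 2)) := by
              rw [Finset.sum_const, Finset.card_range, nsmul_eq_mul, add_assoc, pow_add,
                pow_add, ← mul_assoc (2 ^ T k : ℝ≥0∞), hpow, one_mul]
          _ ≤ 2 ^ T k * (2⁻¹ ^ T k * 2⁻¹ ^ (k + 2)) := by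
              gcongr
              exact_mod_cast Nat.lt_two_pow_self.le
          _ = _ := by rw [← mul_assoc, hpow, one_mul]
    _ = 2⁻¹ := by
        simp_rw [pow_add]
        rw [ENNReal.tsum_mul_right, ENNReal.tsum_geometric, ENNReal.one_sub_inv_two, inv_inv, sq,
          ← mul_assoc, ENNReal.mul_inv_cancel (by simp) (by simp), one_mul]

/-! ### Locality and measurability of algorithms -/

namespace ExpertsAlgorithm

variable {X : Type u} [MeasurableSpace X] (A : ExpertsAlgorithm X)

theorem history_congr (ω : A.Seed) {f f' : ℕ → Payoff X} (t : ℕ) (h : ∀ n < t, f n = f' n) :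
    A.history ω f t = A.history ω f' t := by
  induction t with
  | zero => rfl
  | succ t ih =>
    simp only [history]
    rw [ih fun n hn => h n (hn.trans t.lt_succ_self), h t t.lt_succ_self]

theorem strategy_congr (ω : A.Seed) {f f' : ℕ → Payoff X} (t : ℕ) (h : ∀ n < t, f n = f' n) :
    A.strategy t (ω, f) = A.strategy t (ω, f') := by
  simp only [strategy, A.history_congr ω t h]

section Measurability

variable {B : Type*} [MeasurableSpace B] {Φ : B → Payoff X}

/-- Query points depend on the data, so evaluation has to be measurable jointly in the payoff and
the point. This may fail on all of `Payoff X`, hence the parameter space `B`. -/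
theorem measurable_answers (hΦ : Measurable fun p : B × X => Φ p.1 p.2) (t n : ℕ) :
    Measurable fun q : A.Seed × (Fin t → ℕ → unitInterval) × B =>
      A.answers q.1 t q.2.1 (Φ q.2.2) n := by
  induction n with
  | zero => exact measurable_pi_lambda _ fun i => i.elim0
  | succ n ih =>
    refine measurable_pi_lambda _ fun i => ?_
    refine Fin.lastCases ?_ (fun i => ?_) i
    · simp only [answers, Fin.snoc_last]
      refine hΦ.comp (f := fun q : A.Seed × (Fin t → ℕ → unitInterval) × B =>
        (q.2.2, A.point t n (q.1, q.2.1, A.answers q.1 t q.2.1 (Φ q.2.2) n))) ?_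
      exact (measurable_snd.comp measurable_snd).prodMk ((A.measurable_point t n).comp
        (measurable_fst.prodMk ((measurable_fst.comp measurable_snd).prodMk ih)))
    · simp only [answers, Fin.snoc_castSucc]
      exact (measurable_pi_apply i).comp ih

theorem measurable_history (hΦ : Measurable fun p : B × X => Φ p.1 p.2) (t : ℕ) :
    Measurable fun z : A.Seed × (ℕ → B) => A.history z.1 (fun n => Φ (z.2 n)) t := by
  induction t with
  | zero => exact measurable_pi_lambda _ fun i => i.elim0
  | succ t ih =>
    refine measurable_pi_lambda _ fun i => ?_
    refine Fin.lastCases ?_ (fun i => ?_) i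
    · simp only [history, Fin.snoc_last]
      refine measurable_pi_lambda _ fun n => ?_
      have h1 : Measurable fun z : A.Seed × (ℕ → B) => z.2 t :=
        (measurable_pi_apply t).comp measurable_snd
      refine hΦ.comp (f := fun z : A.Seed × (ℕ → B) =>
        (z.2 t, A.point t n (z.1, A.history z.1 (fun n => Φ (z.2 n)) t,
          A.answers z.1 t (A.history z.1 (fun n => Φ (z.2 n)) t) (Φ (z.2 t)) n))) ?_
      refine h1.prodMk ((A.measurable_point t n).comp (measurable_fst.prodMk (ih.prodMk ?_)))
      exact (A.measurable_answers hΦ t n).comp (measurable_fst.prodMk (ih.prodMk h1))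
    · simp only [history, Fin.snoc_castSucc]
      exact (measurable_pi_apply i).comp ih

theorem measurable_strategy (hΦ : Measurable fun p : B × X => Φ p.1 p.2) (t : ℕ) :
    Measurable fun z : A.Seed × (ℕ → B) => A.strategy t (z.1, fun n => Φ (z.2 n)) :=
  (A.measurable_point t 0).comp
    (measurable_fst.prodMk ((A.measurable_history hΦ t).prodMk measurable_const))

/-- If payoff functions are parametrized jointly measurably by a measurable embedding, then every
algorithm is well defined on the laws on the parameter space. -/
theorem wellDefinedOn_map [Nonempty B]
    (hΦ : Measurable fun p : B × X => Φ p.1 p.2) (hemb : MeasurableEmbedding Φ) (ν : Measure B)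
    [IsProbabilityMeasure ν] : A.WellDefinedOn (ν.map Φ) := by
  intro t
  -- A measurable left inverse `L` of `Φ`: almost every sample lies in the range of `Φ`, where `Φ ∘
  -- L` is the identity.
  obtain ⟨L, hL, hLΦ⟩ := hemb.exists_measurable_extend measurable_id fun _ => inferInstance
  refine ⟨fun z => A.strategy t (z.1, fun n => Φ (L (z.2 n))), ?_, ?_⟩
  · exact (A.measurable_strategy hΦ t).comp (f := fun z : A.Seed × (ℕ → Payoff X) =>
      (z.1, fun n => L (z.2 n))) (measurable_fst.prodMk (measurable_pi_lambda _ fun n =>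
        hL.comp ((measurable_pi_apply n).comp measurable_snd)))
  · have hP : IsProbabilityMeasure (ν.map Φ) :=
      Measure.isProbabilityMeasure_map hemb.measurable.aemeasurable
    have h1 : ∀ᵐ z ∂(A.sampleLaw (ν.map Φ)), ∀ n, z.2 n ∈ Set.range Φ := by
      refine ae_all_iff.2 fun n => ?_
      have hq : Measure.QuasiMeasurePreserving (fun z : A.Seed × (ℕ → Payoff X) => z.2 n)
          (A.sampleLaw (ν.map Φ)) (ν.map Φ) :=
        (measurePreserving_eval_infinitePi (fun _ : ℕ => ν.map Φ) n).quasiMeasurePreserving.comp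
          Measure.quasiMeasurePreserving_snd
      refine hq.ae (p := fun f => f ∈ Set.range Φ) ?_
      exact (ae_map_iff hemb.measurable.aemeasurable hemb.measurableSet_range).2
        (Eventually.of_forall fun b => ⟨b, rfl⟩)
    filter_upwards [h1] with z hz
    have : z.2 = fun n => Φ (L (z.2 n)) := by
      funext n
      obtain ⟨b, hb⟩ := hz n
      rw [← hb]
      exact congrArg Φ (congrFun hLΦ b).symm
    conv_lhs => rw [← Prod.mk.eta (p := z), this]

end Measurability

/-- The samples from the image of a law on a parameter space. -/
theorem sampleLaw_map {B : Type*} [MeasurableSpace B] {Φ : B → Payoff X} (hΦ : Measurable Φ)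
    (ν : Measure B) [IsProbabilityMeasure ν] :
    A.sampleLaw (ν.map Φ) = (A.seedLaw.prod (Measure.infinitePi fun _ : ℕ => ν)).map
      (fun z => (z.1, fun n => Φ (z.2 n))) := by
  have hP : IsProbabilityMeasure (ν.map Φ) := Measure.isProbabilityMeasure_map hΦ.aemeasurable
  have h2 : Measurable fun v : ℕ → B => fun n => Φ (v n) :=
    measurable_pi_lambda _ fun n => hΦ.comp (measurable_pi_apply n)
  rw [sampleLaw, ← Measure.infinitePi_map_pi (fun _ : ℕ => ν) fun _ => hΦ]
  conv_lhs => rw [← Measure.map_id (μ := A.seedLaw)]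
  rw [Measure.map_prod_map _ _ measurable_id h2]
  rfl

end ExpertsAlgorithm

/-! ### Regret as a sum of expected gaps -/

section Regret

variable {X : Type u}

theorem meanPayoff_mem_Icc {P : Measure (Payoff X)} [IsProbabilityMeasure P] (x : X) :
    meanPayoff P x ∈ Set.Icc (0 : ℝ) 1 := by
  refine ⟨integral_nonneg fun f => (f x).2.1, ?_⟩
  have : meanPayoff P x ≤ ∫ _ : Payoff X, (1 : ℝ) ∂P :=
    integral_mono_of_nonneg (Eventually.of_forall fun f => (f x).2.1) (integrable_const _)
      (Eventually.of_forall fun f => (f x).2.2)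
  simpa using this

theorem bddAbove_meanPayoff (P : Measure (Payoff X)) [IsProbabilityMeasure P] :
    BddAbove (Set.range (meanPayoff P)) :=
  ⟨1, by rintro _ ⟨x, rfl⟩; exact (meanPayoff_mem_Icc x).2⟩

variable [MetricSpace X] [MeasurableSpace X] [BorelSpace X] (A : ExpertsAlgorithm X)

instance ExpertsAlgorithm.isProbabilityMeasure_sampleLaw (P : Measure (Payoff X))
    [IsProbabilityMeasure P] : IsProbabilityMeasure (A.sampleLaw P) := by
  unfold ExpertsAlgorithm.sampleLaw
  infer_instance

/-- The regret is the sum over the rounds of the expected gaps. -/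
theorem ExpertsAlgorithm.regret_eq_sum {P : Measure (Payoff X)} (hP : IsLipschitzInstance P)
    (hA : A.WellDefinedOn P) (t : ℕ) :
    A.regret P t = ∑ s ∈ Finset.range t,
      ∫ z, ((⨆ x, meanPayoff P x) - meanPayoff P (A.strategy s z)) ∂(A.sampleLaw P) := by
  have := hP.isProbabilityMeasure
  have hint : ∀ s, Integrable (fun z => meanPayoff P (A.strategy s z)) (A.sampleLaw P) := by
    intro s
    refine Integrable.of_mem_Icc 0 1 (hP.lipschitz.continuous.measurable.comp_aemeasurable (hA s))
      (Eventually.of_forall fun z => meanPayoff_mem_Icc _)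
  rw [ExpertsAlgorithm.regret, integral_finsetSum _ fun s _ => hint s]
  simp_rw [integral_sub (integrable_const _) (hint _)]
  simp [Finset.sum_sub_distrib]

end Regret

/-! ### The hard instances: bumps with planted coins -/

section Bumps

variable {X : Type u} [MetricSpace X] (x : ℕ × ℕ → X) (r : ℝ)

open Classical in
/-- The index of the ball of radius `r` around one of the points `x a` that contains `y`. -/
noncomputable def ballIndex (y : X) : ℕ × ℕ :=
  -- The default is harmless: `bump` vanishes outside all the balls.
  if h : ∃ a, dist y (x a) < r then h.choose else (0, 0)

/-- The sum of bumps of height and radius `r` at the points `x a`. -/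
noncomputable def bump (y : X) : ℝ := max 0 (r - dist y (x (ballIndex x r y)))

/-- The height of the bumps in row `k`. -/
noncomputable def rowWeight (k : ℕ) : ℝ := 1 - 1 / ((k : ℝ) + 2)

/-- Strictness gives the planted point of each row a positive advantage over those of all earlier
rows. -/
theorem rowWeight_strictMono : StrictMono rowWeight := by
  refine strictMono_nat_of_lt_succ fun k => ?_
  unfold rowWeight
  push_cast
  have : 1 / ((k : ℝ) + 1 + 2) < 1 / ((k : ℝ) + 2) := by
    apply one_div_lt_one_div_of_lt <;> linarith [k.cast_nonneg (α := ℝ)]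
  linarith

theorem half_le_rowWeight (k : ℕ) : 1 / 2 ≤ rowWeight k := by
  have h0 : rowWeight 0 = 1 / 2 := by norm_num [rowWeight]
  exact h0 ▸ rowWeight_strictMono.monotone k.zero_le

theorem rowWeight_le_one (k : ℕ) : rowWeight k ≤ 1 := by
  unfold rowWeight
  have : 0 ≤ 1 / ((k : ℝ) + 2) := by positivity
  linarith

/-- The payoff function whose bump at `x a` is present if `b a` is heads. -/
noncomputable def bumpPayoff (b : ℕ × ℕ → Bool) : Payoff X := fun y =>
  Set.projIcc 0 1 zero_le_one
    (rowWeight (ballIndex x r y).1 * (if b (ballIndex x r y) then 1 else 0) * bump x r y)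

variable {x r}

/-- Centres `2 * r` apart have disjoint balls of radius `r`, so the choice in `ballIndex` is forced.
-/
theorem ballIndex_eq (hx : ∀ a b, a ≠ b → 2 * r ≤ dist (x a) (x b)) {y : X} {a : ℕ × ℕ}
    (h : dist y (x a) < r) : ballIndex x r y = a := by
  have h' : ∃ a, dist y (x a) < r := ⟨a, h⟩
  rw [ballIndex, dif_pos h']
  by_contra hne
  have h1 := h'.choose_spec
  have h2 := hx _ _ hne
  linarith [dist_triangle_left (x h'.choose) (x a) y]

theorem bump_nonneg (y : X) : 0 ≤ bump x r y := le_max_left _ _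

theorem bump_le (hr : 0 ≤ r) (y : X) : bump x r y ≤ r :=
  max_le hr (by linarith [dist_nonneg (x := y) (y := x (ballIndex x r y))])

theorem bump_eq (hx : ∀ a b, a ≠ b → 2 * r ≤ dist (x a) (x b)) (hr : 0 < r) (a : ℕ × ℕ) :
    ballIndex x r (x a) = a ∧ bump x r (x a) = r := by
  have h : ballIndex x r (x a) = a := ballIndex_eq hx (by simpa using hr)
  exact ⟨h, by simp [bump, h, hr.le]⟩

theorem bumpPayoff_apply (hr : 0 ≤ r) (hr1 : r ≤ 1) (b : ℕ × ℕ → Bool) (y : X) :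
    (bumpPayoff x r b y : ℝ) =
      rowWeight (ballIndex x r y).1 * (if b (ballIndex x r y) then 1 else 0) * bump x r y := by
  have h1 := bump_nonneg (x := x) (r := r) y
  have h2 := (bump_le (x := x) hr y).trans hr1
  have h3 := half_le_rowWeight (ballIndex x r y).1
  have h4 := rowWeight_le_one (ballIndex x r y).1
  rw [bumpPayoff, Set.projIcc_of_mem zero_le_one]
  split_ifs
  · rw [mul_one]
    exact ⟨by positivity, mul_le_one₀ h4 h1 h2⟩
  · simp

theorem continuous_bumpPayoff : Continuous (bumpPayoff x r) := by
  refine continuous_pi fun y => ?_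
  have h : Continuous fun c : Bool => Set.projIcc (0 : ℝ) 1 zero_le_one
    (rowWeight (ballIndex x r y).1 * (if c then 1 else 0) * bump x r y) :=
    continuous_of_discreteTopology
  exact h.comp (continuous_apply (ballIndex x r y))

/-- The value at the centre `x a` reveals the coin at `a`. -/
theorem bumpPayoff_injective (hx : ∀ a b, a ≠ b → 2 * r ≤ dist (x a) (x b)) (hr : 0 < r)
    (hr1 : r ≤ 1) : Function.Injective (bumpPayoff x r) := by
  intro b b' h
  funext a
  have h1 := congrArg Subtype.val (congrFun h (x a))
  rw [bumpPayoff_apply hr.le hr1, bumpPayoff_apply hr.le hr1, (bump_eq hx hr a).1,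
    (bump_eq hx hr a).2] at h1
  have h3 : 0 < rowWeight a.1 := lt_of_lt_of_le (by norm_num) (half_le_rowWeight a.1)
  have h4 := mul_left_cancel₀ h3.ne' (mul_right_cancel₀ hr.ne' h1)
  cases hb : b a <;> cases hb' : b' a <;> simp_all

instance (X : Type u) : T2Space (Payoff X) := inferInstanceAs (T2Space (X → unitInterval))

/-- A continuous injection of the compact coin space into a Hausdorff space is a closed embedding.
-/
theorem measurableEmbedding_bumpPayoff (hx : ∀ a b, a ≠ b → 2 * r ≤ dist (x a) (x b)) (hr : 0 < r)
    (hr1 : r ≤ 1) : MeasurableEmbedding (bumpPayoff x r) :=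
  ((continuous_bumpPayoff).isClosedEmbedding (bumpPayoff_injective hx hr hr1)).measurableEmbedding

section Measurability

variable [MeasurableSpace X] [BorelSpace X]

theorem measurable_ballIndex (hx : ∀ a b, a ≠ b → 2 * r ≤ dist (x a) (x b)) :
    Measurable (ballIndex x r) := by
  refine measurable_to_countable' fun a => ?_
  -- The fibre over the default index also contains all points outside the balls.
  by_cases ha : a = (0, 0)
  · have : ballIndex x r ⁻¹' {a} = (⋃ b : {b // b ≠ a}, Metric.ball (x b) r)ᶜ := by
      ext y
      simp only [Set.mem_preimage, Set.mem_singleton_iff, Set.mem_compl_iff, Set.mem_iUnion,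
        Metric.mem_ball, not_exists]
      constructor
      · rintro h ⟨b, hb⟩ hy
        exact hb ((ballIndex_eq hx hy).symm.trans h)
      · intro h
        by_cases h' : ∃ b, dist y (x b) < r
        · obtain ⟨b, hb⟩ := h'
          by_cases hba : b = a
          · rw [ballIndex_eq hx hb, hba]
          · exact absurd hb (h ⟨b, hba⟩)
        · rw [ballIndex, dif_neg h', ha]
    rw [this]
    exact (MeasurableSet.iUnion fun b => Metric.isOpen_ball.measurableSet).compl
  · have : ballIndex x r ⁻¹' {a} = Metric.ball (x a) r := by
      ext y
      simp only [Set.mem_preimage, Set.mem_singleton_iff, Metric.mem_ball]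
      refine ⟨fun h => ?_, ballIndex_eq hx⟩
      by_cases h' : ∃ b, dist y (x b) < r
      · rw [ballIndex, dif_pos h'] at h
        exact h ▸ h'.choose_spec
      · rw [ballIndex, dif_neg h'] at h
        exact absurd h.symm ha
    rw [this]
    exact Metric.isOpen_ball.measurableSet

theorem measurable_bump (hx : ∀ a b, a ≠ b → 2 * r ≤ dist (x a) (x b)) :
    Measurable (bump x r) := by
  have h : Measurable fun p : X × (ℕ × ℕ) => dist p.1 (x p.2) :=
    measurable_from_prod_countable_left fun a => (continuous_id.dist continuous_const : Continuous fun y => dist y (x a)).measurable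
  exact measurable_const.max (measurable_const.sub
    (h.comp (measurable_id.prodMk (measurable_ballIndex hx))))

theorem measurable_bumpPayoff (hx : ∀ a b, a ≠ b → 2 * r ≤ dist (x a) (x b)) :
    Measurable fun p : (ℕ × ℕ → Bool) × X => bumpPayoff x r p.1 p.2 := by
  have h1 : Measurable fun p : (ℕ × ℕ → Bool) × X => ballIndex x r p.2 :=
    (measurable_ballIndex hx).comp measurable_snd
  have h2 : Measurable fun q : (ℕ × ℕ → Bool) × (ℕ × ℕ) => (if q.1 q.2 then (1 : ℝ) else 0) :=
    measurable_from_prod_countable_left fun a =>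
      (Measurable.of_discrete (f := fun c : Bool => if c then (1 : ℝ) else 0)).comp
        (measurable_pi_apply a)
  refine continuous_projIcc.measurable.comp ((Measurable.mul ?_ ?_).mul ?_)
  · exact (Measurable.of_discrete (f := fun a : ℕ × ℕ => rowWeight a.1)).comp h1
  · exact h2.comp (measurable_fst.prodMk h1)
  · exact (measurable_bump hx).comp measurable_snd

end Measurability

/-- The law of the bump payoffs for fair coins planted along `θ`. -/
noncomputable def plantedLaw (x : ℕ × ℕ → X) (r : ℝ) (θ : ℕ → ℕ) : Measure (Payoff X) :=
  (coins (ℕ × ℕ)).map fun v => bumpPayoff x r (plant θ v)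

theorem measurable_plant_right (θ : ℕ → ℕ) : Measurable (plant θ) :=
  measurable_plant.comp (f := fun v : ℕ × ℕ → Bool => (θ, v)) (by fun_prop)

/-- The expected coin, with planted coins. -/
noncomputable def plantedMean (θ : ℕ → ℕ) (a : ℕ × ℕ) : ℝ :=
  rowWeight a.1 * (if a.2 = θ a.1 then 1 else 1 / 2)

theorem plantedMean_nonneg (θ : ℕ → ℕ) (a : ℕ × ℕ) : 0 ≤ plantedMean θ a := by
  have := half_le_rowWeight a.1
  unfold plantedMean
  positivity

theorem plantedMean_le_rowWeight (θ : ℕ → ℕ) (a : ℕ × ℕ) : plantedMean θ a ≤ rowWeight a.1 := by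
  have := half_le_rowWeight a.1
  unfold plantedMean
  split_ifs <;> linarith

theorem plantedMean_le_half (θ : ℕ → ℕ) {a : ℕ × ℕ} (h : a.2 ≠ θ a.1) :
    plantedMean θ a ≤ 1 / 2 := by
  have := rowWeight_le_one a.1
  simp only [plantedMean, h, if_false]
  linarith

theorem meanPayoff_plantedLaw (hr : 0 ≤ r) (hr1 : r ≤ 1) (θ : ℕ → ℕ) (y : X) :
    meanPayoff (plantedLaw x r θ) y = plantedMean θ (ballIndex x r y) * bump x r y := by
  set a := ballIndex x r y
  have hm : Measurable fun v : ℕ × ℕ → Bool => bumpPayoff x r (plant θ v) :=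
    continuous_bumpPayoff.measurable.comp (measurable_plant_right θ)
  have hev : Measurable fun f : Payoff X => (f y : ℝ) :=
    (continuous_subtype_val.comp (continuous_apply y)).measurable
  rw [meanPayoff, plantedLaw, integral_map hm.aemeasurable hev.aestronglyMeasurable]
  simp_rw [bumpPayoff_apply hr hr1]
  rw [integral_mul_const, integral_const_mul]
  congr 1
  rw [plantedMean]
  congr 1
  have : ∀ v : ℕ × ℕ → Bool, (if plant θ v a then (1 : ℝ) else 0) =
      (fun c : Bool => if (decide (a.2 = θ a.1) || c) then (1 : ℝ) else 0) (v a) := fun v => rfl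
  change ∫ v, (if plant θ v a then (1 : ℝ) else 0) ∂(coins (ℕ × ℕ)) = _
  simp_rw [this]
  rw [← integral_map (μ := coins (ℕ × ℕ)) (φ := fun v : ℕ × ℕ → Bool => v a)
    (f := fun c : Bool => if (decide (a.2 = θ a.1) || c) then (1 : ℝ) else 0)
    (measurable_pi_apply a).aemeasurable (Measurable.of_discrete).aestronglyMeasurable,
    Measure.infinitePi_map_eval, integral_coin]
  by_cases h : a.2 = θ a.1 <;> simp [h]

/-- The mean consists of tents of slope at most 1 on disjoint balls. In the one-sided estimate only
the tent over `y` matters: if `z` lies outside its ball, the tent has already descended to 0 on the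
way. -/
theorem isLipschitzInstance_plantedLaw (hx : ∀ a b, a ≠ b → 2 * r ≤ dist (x a) (x b)) (hr : 0 < r)
    (hr1 : r ≤ 1) (θ : ℕ → ℕ) : IsLipschitzInstance (plantedLaw x r θ) where
  isProbabilityMeasure := Measure.isProbabilityMeasure_map
    (continuous_bumpPayoff.measurable.comp (measurable_plant_right θ)).aemeasurable
  lipschitz := by
    refine LipschitzWith.of_le_add fun y z => ?_
    rw [meanPayoff_plantedLaw hr.le hr1, meanPayoff_plantedLaw hr.le hr1]
    set a := ballIndex x r y with ha
    have hp0 := plantedMean_nonneg θ a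
    have hp1 : plantedMean θ a ≤ 1 := (plantedMean_le_rowWeight θ a).trans (rowWeight_le_one _)
    have hz0 : 0 ≤ plantedMean θ (ballIndex x r z) * bump x r z :=
      mul_nonneg (plantedMean_nonneg _ _) (bump_nonneg _)
    have htri := dist_triangle_left z (x a) y
    have hyz := dist_nonneg (x := y) (y := z)
    have hby : bump x r y = max 0 (r - dist y (x a)) := rfl
    rcases le_or_gt r (dist y (x a)) with h | h
    · rw [hby, max_eq_left (by linarith)]
      linarith
    rw [hby, max_eq_right (by linarith)]
    rcases le_or_gt r (dist z (x a)) with h' | h'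
    · have : plantedMean θ a * (r - dist y (x a)) ≤ r - dist y (x a) :=
        mul_le_of_le_one_left (by linarith) hp1
      have := dist_triangle z y (x a)
      rw [dist_comm z y] at this
      linarith
    · have hza : ballIndex x r z = a := ballIndex_eq hx h'
      have : bump x r z = r - dist z (x a) := by
        rw [bump, hza, max_eq_right (by linarith)]
      rw [hza, this]
      have h3 := dist_triangle z y (x a)
      rw [dist_comm z y] at h3
      nlinarith

end Bumps

/-! ### The lower bound without total boundedness -/

theorem exists_horizons {g : ℕ → ℝ} (hg : g =o[atTop] (fun t : ℕ => (t : ℝ))) {c : ℕ → ℝ}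
    (hc : ∀ k, 0 < c k) : ∃ T : ℕ → ℕ, StrictMono T ∧ ∀ k, k * |g (T k)| < c k * T k := by
  refine extraction_forall_of_eventually (P := fun k t => k * |g t| < c k * t) fun k => ?_
  -- Dividing by `k + 1` covers `k = 0` and makes the final inequality strict.
  have hk : (0 : ℝ) < k + 1 := by positivity
  filter_upwards [isLittleO_iff.1 hg (div_pos (hc k) hk), eventually_gt_atTop 0] with t ht ht0
  rw [Real.norm_eq_abs, Real.norm_eq_abs, Nat.abs_cast] at ht
  have ht1 : (0 : ℝ) < t := by exact_mod_cast ht0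
  have hct : 0 < c k / (k + 1) * t := mul_pos (div_pos (hc k) hk) ht1
  calc k * |g t| ≤ k * (c k / (k + 1) * t) := by gcongr
    _ < (k + 1) * (c k / (k + 1) * t) := by nlinarith
    _ = c k * t := by field_simp

section

variable {X : Type u} [MetricSpace X] [MeasurableSpace X] [BorelSpace X]

/-- The constant may depend on the instance, so one instance has to be bad at infinitely many
horizons; this is why every row gets a planted coin. -/
theorem not_fullFeedbackTractable_of_separated {x : ℕ × ℕ → X} {r : ℝ}
    (hx : ∀ a b, a ≠ b → 2 * r ≤ dist (x a) (x b)) (hr : 0 < r) (hr1 : r ≤ 1) {g : ℕ → ℝ}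
    (hg : g =o[atTop] (fun t : ℕ => (t : ℝ))) : ¬ FullFeedbackTractable X g := by
  rintro ⟨A, hA⟩
  set δ : ℕ → ℝ := fun k => r * (rowWeight (k + 1) - rowWeight k) with hδ
  have hδ0 : ∀ k, 0 < δ k := fun k =>
    mul_pos hr (sub_pos.2 (rowWeight_strictMono k.lt_succ_self))
  obtain ⟨T, hT, hTg⟩ := exists_horizons hg fun k => half_pos (hδ0 k)
  set K : ℕ → A.Seed × (ℕ → ℕ × ℕ → Bool) → ℕ × ℕ := fun s z =>
    ballIndex x r (A.strategy s (z.1, fun n => bumpPayoff x r (z.2 n))) with hKdef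
  have hK : ∀ s, Measurable (K s) := fun s =>
    (measurable_ballIndex hx).comp (A.measurable_strategy (measurable_bumpPayoff hx) s)
  have hloc : ∀ s ω v v', (∀ n < s, v n = v' n) → K s (ω, v) = K s (ω, v') := by
    intro s ω v v' h
    exact congrArg (ballIndex x r) (A.strategy_congr ω s fun n hn =>
      congrArg (bumpPayoff x r) (h n hn))
  obtain ⟨θ, hθ⟩ := exists_plant_avoid A.seedLaw K hK hloc T
  set M := A.seedLaw.prod (Measure.infinitePi fun _ : ℕ => coins (ℕ × ℕ)) with hM
  have hP := isLipschitzInstance_plantedLaw hx hr hr1 θ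
  have hPp := hP.isProbabilityMeasure
  have hW : A.WellDefinedOn (plantedLaw x r θ) := by
    have hν : IsProbabilityMeasure ((coins (ℕ × ℕ)).map (plant θ)) :=
      Measure.isProbabilityMeasure_map (measurable_plant_right θ).aemeasurable
    have := A.wellDefinedOn_map (measurable_bumpPayoff hx) (measurableEmbedding_bumpPayoff hx hr hr1)
      ((coins (ℕ × ℕ)).map (plant θ))
    rwa [Measure.map_map continuous_bumpPayoff.measurable (measurable_plant_right θ)] at this
  have hΦ : Measurable fun v => bumpPayoff x r (plant θ v) :=
    continuous_bumpPayoff.measurable.comp (measurable_plant_right θ)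
  have hΨ : Measurable fun z : A.Seed × (ℕ → ℕ × ℕ → Bool) =>
      (z.1, fun n => bumpPayoff x r (plant θ (z.2 n))) :=
    measurable_fst.prodMk (measurable_pi_lambda _ fun n =>
      hΦ.comp ((measurable_pi_apply n).comp measurable_snd))
  have hplant : Measurable fun z : A.Seed × (ℕ → ℕ × ℕ → Bool) =>
      (z.1, fun n => plant θ (z.2 n)) :=
    measurable_fst.prodMk (measurable_pi_lambda _ fun n =>
      (measurable_plant_right θ).comp ((measurable_pi_apply n).comp measurable_snd))
  have hlaw : A.sampleLaw (plantedLaw x r θ) =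
      M.map (fun z => (z.1, fun n => bumpPayoff x r (plant θ (z.2 n)))) :=
    A.sampleLaw_map hΦ (coins (ℕ × ℕ))
  have hmc : Measurable (meanPayoff (plantedLaw x r θ)) := hP.lipschitz.continuous.measurable
  have hsup : ∀ k, r * rowWeight k ≤ ⨆ y, meanPayoff (plantedLaw x r θ) y := by
    intro k
    refine le_trans (le_of_eq ?_) (le_ciSup (bddAbove_meanPayoff _) (x (k, θ k)))
    rw [meanPayoff_plantedLaw hr.le hr1, (bump_eq hx hr _).1, (bump_eq hx hr _).2]
    simp [plantedMean, mul_comm]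
  have hround : ∀ k s, s < T k → δ k / 2 ≤ ∫ z, ((⨆ y, meanPayoff (plantedLaw x r θ) y) -
      meanPayoff (plantedLaw x r θ) (A.strategy s z)) ∂(A.sampleLaw (plantedLaw x r θ)) := by
    intro k s hs
    rw [hlaw, integral_map hΨ.aemeasurable (by
      rw [← hlaw]
      exact (aemeasurable_const.sub (hmc.comp_aemeasurable (hW s))).aestronglyMeasurable)]
    set hit : ℕ → Set (A.Seed × (ℕ → ℕ × ℕ → Bool)) := fun j =>
      {z | K s (z.1, fun n => plant θ (z.2 n)) = (j, θ j)} with hhit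
    -- Only rows whose horizon is still ahead count; a hit in a row `j` with `T j ≤ s` is allowed.
    set bad := ⋃ j : {j // s < T j}, hit j with hbad
    have hhitm : ∀ j, MeasurableSet (hit j) := fun j =>
      measurableSet_eq_fun ((hK s).comp hplant) measurable_const
    have hbadm : MeasurableSet bad := MeasurableSet.iUnion fun j => hhitm j
    have hbad2 : M bad ≤ 2⁻¹ := by
      calc M bad ≤ ∑' j : {j // s < T j}, M (hit j) := measure_iUnion_le _
        _ ≤ ∑' j : {j // s < T j}, ∑ s ∈ Finset.range (T j),
            M {z | K s (z.1, fun n => plant θ (z.2 n)) = ((j : ℕ), θ j)} :=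
          ENNReal.tsum_le_tsum fun j => Finset.single_le_sum
            (f := fun s => M {z | K s (z.1, fun n => plant θ (z.2 n)) = ((j : ℕ), θ j)})
            (fun _ _ => zero_le) (Finset.mem_range.2 j.2)
        _ ≤ _ := ENNReal.tsum_comp_le_tsum_of_injective Subtype.val_injective
            (fun j => ∑ s ∈ Finset.range (T j),
              M {z | K s (z.1, fun n => plant θ (z.2 n)) = (j, θ j)})
        _ ≤ 2⁻¹ := hθ
    have hgood : 1 / 2 ≤ M.real badᶜ := by
      rw [probReal_compl_eq_one_sub hbadm]
      have : M.real bad ≤ 1 / 2 := by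
        have := ENNReal.toReal_mono (by simp) hbad2
        simpa [Measure.real] using this
      linarith
    have hstrat : Measurable fun z : A.Seed × (ℕ → ℕ × ℕ → Bool) =>
        A.strategy s (z.1, fun n => bumpPayoff x r (plant θ (z.2 n))) :=
      (A.measurable_strategy (measurable_bumpPayoff hx) s).comp hplant
    calc δ k / 2 ≤ M.real badᶜ * δ k := by nlinarith [hδ0 k]
      _ = ∫ z, badᶜ.indicator (fun _ => δ k) z ∂M := by
        rw [integral_indicator_const _ hbadm.compl, smul_eq_mul]
      _ ≤ _ := by
        refine integral_mono ((integrable_const _).indicator hbadm.compl)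
          ((integrable_const _).sub (Integrable.of_mem_Icc 0 1
            (hmc.comp hstrat).aemeasurable (Eventually.of_forall fun z => meanPayoff_mem_Icc _)))
          fun z => ?_
        by_cases hz : z ∈ bad
        · simp only [Set.indicator_of_notMem (Set.notMem_compl_iff.2 hz)]
          exact sub_nonneg.2 (le_ciSup (bddAbove_meanPayoff _) _)
        · simp only [Set.indicator_of_mem (Set.mem_compl hz)]
          have hsk := hsup (k + 1)
          rw [meanPayoff_plantedLaw hr.le hr1]
          set y := A.strategy s (z.1, fun n => bumpPayoff x r (plant θ (z.2 n))) with hy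
          have hmean : plantedMean θ (ballIndex x r y) ≤ rowWeight k := by
            by_cases ha : (ballIndex x r y).2 = θ (ballIndex x r y).1
            · refine (plantedMean_le_rowWeight θ _).trans
                (rowWeight_strictMono.monotone (le_of_not_gt fun hlt => hz ?_))
              -- A planted row beyond `k` has a later horizon by monotonicity of `T`, so hitting it
              -- would put `z` in `bad`.
              refine Set.mem_iUnion.2 ⟨⟨(ballIndex x r y).1, hs.trans (hT hlt)⟩, ?_⟩
              exact Prod.ext rfl ha
            · exact (plantedMean_le_half θ ha).trans (half_le_rowWeight k)
          have h1 : plantedMean θ (ballIndex x r y) * bump x r y ≤ rowWeight k * r :=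
            mul_le_mul hmean (bump_le hr.le y) (bump_nonneg y)
              ((plantedMean_nonneg θ _).trans hmean)
          simp only [hδ]
          linarith
  obtain ⟨C, hC⟩ := hA _ hP hW
  -- The factor `k` in the choice of horizons now absorbs `C`.
  obtain ⟨k, hk⟩ := exists_nat_ge |C|
  have h1 : δ k / 2 * T k ≤ A.regret (plantedLaw x r θ) (T k) := by
    rw [A.regret_eq_sum hP hW]
    calc δ k / 2 * T k = ∑ s ∈ Finset.range (T k), δ k / 2 := by simp [mul_comm]
      _ ≤ _ := Finset.sum_le_sum fun s hs => hround k s (Finset.mem_range.1 hs)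
  have h2 : C * g (T k) ≤ k * |g (T k)| :=
    (le_abs_self _).trans ((abs_mul C _).le.trans (by gcongr))
  linarith [hC (T k), hTg k]

theorem not_fullFeedbackTractable_of_not_totallyBounded
    (h : ¬ TotallyBounded (Set.univ : Set X)) {g : ℕ → ℝ}
    (hg : g =o[atTop] (fun t : ℕ => (t : ℝ))) : ¬ FullFeedbackTractable X g := by
  rw [Metric.totallyBounded_iff] at h
  push Not at h
  obtain ⟨ε, hε, h⟩ := h
  have hex : ∀ s : Finset X, ∃ y, ∀ z ∈ s, ε ≤ dist z y := by
    intro s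
    have := h s s.finite_toSet
    rw [Set.not_subset] at this
    obtain ⟨y, -, hy⟩ := this
    refine ⟨y, fun z hz => ?_⟩
    by_contra hlt
    exact hy (Set.mem_biUnion (Finset.mem_coe.2 hz) (by
      rw [Metric.mem_ball, dist_comm]; exact not_le.1 hlt))
  have hsymm : Std.Symm fun z y : X => ε ≤ dist z y := ⟨fun a b hab => by rwa [dist_comm]⟩
  obtain ⟨f, -, hf⟩ := exists_seq_of_forall_finset_exists' (fun _ : X => True)
    (fun z y => ε ≤ dist z y) (fun s _ => by simpa using hex s)
  refine not_fullFeedbackTractable_of_separated (x := fun a => f (Nat.pair a.1 a.2))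
    (r := min 1 (ε / 2)) (fun a b hab => ?_) (lt_min one_pos (half_pos hε)) (min_le_left _ _) hg
  have hne : Nat.pair a.1 a.2 ≠ Nat.pair b.1 b.2 := fun h => hab (by
    have := Nat.pair_eq_pair.1 h
    exact Prod.ext this.1 this.2)
  have := hf hne
  linarith [min_le_right 1 (ε / 2)]

end

/-! ### Bandit algorithms on a countable set of arms -/

namespace ExpertsAlgorithm

variable {X : Type u} [MeasurableSpace X] (A : ExpertsAlgorithm X)

theorem history_apply_zero (ω : A.Seed) (f : ℕ → Payoff X) (t s : ℕ) (hs : s < t) :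
    A.history ω f t ⟨s, hs⟩ 0 = f s (A.strategy s (ω, f)) := by
  induction t with
  | zero => exact absurd hs s.not_lt_zero
  | succ t ih =>
    rcases Nat.lt_succ_iff_lt_or_eq.1 hs with h | h
    · rw [← ih h]
      exact congrFun (Fin.snoc_castSucc (α := fun _ => ℕ → unitInterval) _ _ (⟨s, h⟩ : Fin t)) 0
    · subst h
      exact congrFun (Fin.snoc_last (α := fun _ => ℕ → unitInterval) _ _) 0

/-- The payoffs received in the first `t` rounds, continued by zeros. -/
def payoffs {t : ℕ} (h : Fin t → ℕ → unitInterval) (s : ℕ) : ℝ :=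
  if hs : s < t then h ⟨s, hs⟩ 0 else 0

theorem measurable_payoffs (t : ℕ) :
    Measurable (payoffs : (Fin t → ℕ → unitInterval) → ℕ → ℝ) := by
  refine measurable_pi_lambda _ fun s => ?_
  by_cases hs : s < t
  · simp only [payoffs, hs, dif_pos]
    fun_prop
  · simp [payoffs, hs]

/-- The deterministic bandit algorithm that plays the point `x (c t p)` in round `t` after the
payoffs `p`. -/
noncomputable def ofChoice (x : ℕ → X) (c : ℕ → (ℕ → ℝ) → ℕ) (hc : ∀ t, Measurable (c t)) :
    ExpertsAlgorithm X where
  Seed := PUnit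
  seedLaw := Measure.dirac PUnit.unit
  point t _ q := x (c t (payoffs q.2.1))
  measurable_point t _ := (Measurable.of_discrete (f := x)).comp
    ((hc t).comp ((measurable_payoffs t).comp (measurable_fst.comp measurable_snd)))

variable (x : ℕ → X) (c : ℕ → (ℕ → ℝ) → ℕ) (hc : ∀ t, Measurable (c t))

theorem ofChoice_usesBanditFeedback : (ofChoice x c hc).UsesBanditFeedback := by
  intro t ω h h' a hh
  have : payoffs h = payoffs h' := by
    funext s
    simp only [payoffs, hh]
  simp [ofChoice, this]

/-- The payoffs received by the algorithm `ofChoice x c` in the first `t` rounds. -/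
noncomputable def ofChoicePayoffs (t : ℕ) (z : (ofChoice x c hc).Seed × (ℕ → Payoff X)) : ℕ → ℝ :=
  payoffs ((ofChoice x c hc).history z.1 z.2 t)

theorem ofChoice_strategy (t : ℕ) (z : (ofChoice x c hc).Seed × (ℕ → Payoff X)) :
    (ofChoice x c hc).strategy t z = x (c t (ofChoicePayoffs x c hc t z)) := rfl

theorem ofChoicePayoffs_apply {t s : ℕ} (hs : s < t)
    (z : (ofChoice x c hc).Seed × (ℕ → Payoff X)) :
    ofChoicePayoffs x c hc t z s = z.2 s (x (c s (ofChoicePayoffs x c hc s z))) := by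
  rw [ofChoicePayoffs, payoffs, dif_pos hs, history_apply_zero]
  rfl

/-- Only countably many points are ever played, so measurability of each single evaluation suffices,
on every instance. -/
theorem measurable_ofChoicePayoffs (t : ℕ) : Measurable (ofChoicePayoffs x c hc t) := by
  induction t using Nat.strong_induction_on with
  | _ t ih =>
    refine measurable_pi_lambda _ fun s => ?_
    by_cases hs : s < t
    · simp_rw [ofChoicePayoffs_apply x c hc hs]
      have h : Measurable fun p : Payoff X × ℕ => (p.1 (x p.2) : ℝ) :=
        measurable_from_prod_countable_left fun j =>
          (continuous_subtype_val.comp (continuous_apply (x j))).measurable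
      exact h.comp (((measurable_pi_apply s).comp measurable_snd).prodMk ((hc s).comp (ih s hs)))
    · simp only [ofChoicePayoffs, payoffs, hs, dif_neg, not_false_eq_true]
      exact measurable_const

theorem ofChoice_measurable_strategy (t : ℕ) : Measurable ((ofChoice x c hc).strategy t) :=
  (Measurable.of_discrete (f := x)).comp ((hc t).comp (measurable_ofChoicePayoffs x c hc t))

end ExpertsAlgorithm

/-! ### Errors of empirical means -/

section Estimates

variable {X : Type u}

theorem measurable_payoff_apply (y : X) : Measurable fun f : Payoff X => (f y : ℝ) :=
  (continuous_subtype_val.comp (continuous_apply y)).measurable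

/-- The mean squared error of the average of `m` independent observations. -/
theorem integral_sq_average_sub_le (P : Measure (Payoff X)) [IsProbabilityMeasure P] (y : X)
    {q : ℕ → ℕ} (hq : Function.Injective q) {m : ℕ} (hm : 0 < m) :
    ∫ f : ℕ → Payoff X, ((∑ l ∈ Finset.range m, (f (q l) y : ℝ)) / m - meanPayoff P y) ^ 2
      ∂(Measure.infinitePi fun _ => P) ≤ 1 / m := by
  set M := Measure.infinitePi fun _ : ℕ => P
  set Y : ℕ → (ℕ → Payoff X) → ℝ := fun l f => (f (q l) y : ℝ) with hY
  have hYm : ∀ l, Measurable (Y l) := fun l =>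
    (measurable_payoff_apply y).comp (measurable_pi_apply (q l))
  have hYb : ∀ l, ∀ᵐ f ∂M, Y l f ∈ Set.Icc (0 : ℝ) 1 := fun l =>
    Eventually.of_forall fun f => (f (q l) y).2
  have hYL : ∀ l, MemLp (Y l) 2 M := fun l =>
    memLp_of_bounded (hYb l) (hYm l).aestronglyMeasurable 2
  have hmean : ∀ l, ∫ f, Y l f ∂M = meanPayoff P y := by
    intro l
    have := integral_map (μ := M) (φ := fun f : ℕ → Payoff X => f (q l))
      (f := fun f : Payoff X => (f y : ℝ)) (measurable_pi_apply (q l)).aemeasurable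
      (measurable_payoff_apply y).aestronglyMeasurable
    rw [Measure.infinitePi_map_eval] at this
    exact this.symm
  have hind : iIndepFun (fun (n : ℕ) (f : ℕ → Payoff X) => (f n y : ℝ)) M :=
    iIndepFun_infinitePi (X := fun _ : ℕ => fun f : Payoff X => (f y : ℝ))
      fun _ => measurable_payoff_apply y
  have hvar : Var[∑ l ∈ Finset.range m, Y l; M] ≤ m := by
    rw [IndepFun.variance_sum (fun l _ => hYL l)
      fun i _ j _ hij => hind.indepFun (hq.ne hij)]
    calc _ ≤ ∑ l ∈ Finset.range m, (1 : ℝ) := by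
          refine Finset.sum_le_sum fun l _ => ?_
          have := variance_le_sq_of_bounded (hYb l) (hYm l).aemeasurable
          norm_num at this
          linarith
      _ = m := by simp
  rw [variance_eq_integral (Finset.aemeasurable_sum _ fun l _ => (hYm l).aemeasurable)] at hvar
  have hm' : (0 : ℝ) < m := by exact_mod_cast hm
  have hE : ∫ f, (∑ l ∈ Finset.range m, Y l) f ∂M = m * meanPayoff P y := by
    simp only [Finset.sum_apply]
    rw [integral_finsetSum _ fun l _ => (hYL l).integrable (by norm_num)]
    simp [hmean]
  rw [hE] at hvar
  have hrw : ∀ f : ℕ → Payoff X, ((∑ l ∈ Finset.range m, (f (q l) y : ℝ)) / m -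
      meanPayoff P y) ^ 2 = (((∑ l ∈ Finset.range m, Y l) f - m * meanPayoff P y) ^ 2) / m ^ 2 := by
    intro f
    simp only [Finset.sum_apply, hY]
    field_simp
  simp_rw [hrw]
  rw [integral_div, div_le_div_iff₀ (by positivity) hm']
  nlinarith

theorem measurable_average_sub (P : Measure (Payoff X)) (y : X) (q : ℕ → ℕ) (m : ℕ) :
    Measurable fun f : ℕ → Payoff X =>
      (∑ l ∈ Finset.range m, (f (q l) y : ℝ)) / m - meanPayoff P y :=
  ((Finset.measurable_fun_sum _ fun l _ =>
    (measurable_payoff_apply y).comp (measurable_pi_apply (q l))).div_const _).sub_const _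

theorem abs_average_sub_le_one (P : Measure (Payoff X)) [IsProbabilityMeasure P] (y : X)
    (q : ℕ → ℕ) (m : ℕ) (f : ℕ → Payoff X) :
    |(∑ l ∈ Finset.range m, (f (q l) y : ℝ)) / m - meanPayoff P y| ≤ 1 := by
  have hμ := meanPayoff_mem_Icc (P := P) y
  have h0 : 0 ≤ (∑ l ∈ Finset.range m, (f (q l) y : ℝ)) / m :=
    div_nonneg (Finset.sum_nonneg fun l _ => (f (q l) y).2.1) (Nat.cast_nonneg _)
  have h1 : (∑ l ∈ Finset.range m, (f (q l) y : ℝ)) / m ≤ 1 := by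
    refine div_le_one_of_le₀ ?_ (Nat.cast_nonneg _)
    calc _ ≤ ∑ l ∈ Finset.range m, (1 : ℝ) := Finset.sum_le_sum fun l _ => (f (q l) y).2.2
      _ = _ := by simp
  exact abs_le.2 ⟨by linarith [hμ.2], by linarith [hμ.1]⟩

/-- The variance bound is turned into a first-moment bound by |e| ≤ 1/(2D) + D e²/2; with D² samples
both terms contribute 1/(2D). -/
theorem integral_abs_average_sub_le (P : Measure (Payoff X)) [IsProbabilityMeasure P] (y : X)
    {q : ℕ → ℕ} (hq : Function.Injective q) {D : ℕ} (hD : 0 < D) :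
    ∫ f : ℕ → Payoff X, |(∑ l ∈ Finset.range (D ^ 2), (f (q l) y : ℝ)) / ((D ^ 2 : ℕ) : ℝ) -
      meanPayoff P y| ∂(Measure.infinitePi fun _ => P) ≤ 1 / D := by
  have hD' : (0 : ℝ) < D := by exact_mod_cast hD
  have h := integral_sq_average_sub_le P y hq (pow_pos hD 2)
  set M := Measure.infinitePi fun _ : ℕ => P
  set e : (ℕ → Payoff X) → ℝ := fun f =>
    (∑ l ∈ Finset.range (D ^ 2), (f (q l) y : ℝ)) / ((D ^ 2 : ℕ) : ℝ) - meanPayoff P y with he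
  have hem : Measurable e := measurable_average_sub P y _ _
  have heb : ∀ f, |e f| ≤ 1 := abs_average_sub_le_one P y _ _
  have hi1 : Integrable (fun f => |e f|) M :=
    Integrable.of_mem_Icc 0 1 hem.abs.aemeasurable
      (Eventually.of_forall fun f => ⟨abs_nonneg _, heb f⟩)
  have hi2 : Integrable (fun f => e f ^ 2) M :=
    Integrable.of_mem_Icc 0 1 (hem.pow_const 2).aemeasurable
      (Eventually.of_forall fun f => ⟨sq_nonneg _, (sq_le_one_iff_abs_le_one _).2 (heb f)⟩)
  calc ∫ f, |e f| ∂M ≤ ∫ f, (1 / (2 * D) + D / 2 * e f ^ 2) ∂M := by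
        refine integral_mono hi1 ((integrable_const _).add (hi2.const_mul _)) fun f => ?_
        have h2 := sq_nonneg (1 - D * |e f|)
        rw [← sq_abs (e f)]
        have h3 : |e f| * (2 * D) ≤ (1 / (2 * D) + D / 2 * |e f| ^ 2) * (2 * D) := by
          field_simp
          nlinarith
        exact le_of_mul_le_mul_right h3 (by positivity)
    _ = 1 / (2 * D) + D / 2 * ∫ f, e f ^ 2 ∂M := by
        rw [integral_add (integrable_const _) (hi2.const_mul _), integral_const_mul]
        simp
    _ ≤ 1 / (2 * D) + D / 2 * (1 / ((D ^ 2 : ℕ) : ℝ)) := by gcongr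
    _ = 1 / D := by
        push_cast
        field_simp
        ring

end Estimates

/-! ### Slow growth and sublinear sums -/

/-- Any family of properties that hold eventually can be followed along a slowly growing
sequence. -/
theorem exists_tendsto_forall_eventually {p : ℕ → ℕ → Prop} (h : ∀ k, ∀ᶠ t in atTop, p k t) :
    ∃ κ : ℕ → ℕ, Tendsto κ atTop atTop ∧ ∀ᶠ t in atTop, p (κ t) t := by
  obtain ⟨φ, hφ, hp⟩ := extraction_forall_of_eventually (P := fun k N => ∀ t ≥ N, p k t)
    fun k => by
      obtain ⟨N, hN⟩ := eventually_atTop.1 (h k)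
      exact eventually_atTop.2 ⟨N, fun n hn t ht => hN t (hn.trans ht)⟩
  refine ⟨fun t => Nat.findGreatest (fun k => φ k ≤ t) t, tendsto_atTop.2 fun b => ?_, ?_⟩
  · filter_upwards [eventually_ge_atTop (φ b)] with t ht
    exact Nat.le_findGreatest ((hφ.id_le b).trans ht) ht
  -- From `φ 0` on, the set searched by `Nat.findGreatest` contains 0, so its value satisfies the
  -- predicate.
  · filter_upwards [eventually_ge_atTop (φ 0)] with t ht
    exact hp _ t (Nat.findGreatest_spec (P := fun k => φ k ≤ t) t.zero_le ht)

theorem isLittleO_sum_isSquare :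
    (fun T : ℕ => ∑ t ∈ Finset.range T, if IsSquare t then (1 : ℝ) else 0) =o[atTop]
      fun T : ℕ => (T : ℝ) := by
  rw [isLittleO_iff]
  intro c hc
  -- There are at most √T + 1 ≤ 2√T squares below T, and this is at most cT once c√T ≥ 2.
  obtain ⟨n, hn⟩ := exists_nat_gt (2 / c)
  filter_upwards [eventually_ge_atTop ((n + 1) ^ 2)] with T hT
  have hs : n + 1 ≤ Nat.sqrt T := Nat.le_sqrt'.2 hT
  have hcard : ∑ t ∈ Finset.range T, (if IsSquare t then (1 : ℝ) else 0) ≤ Nat.sqrt T + 1 := by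
    rw [Finset.sum_boole]
    have : (Finset.range T).filter IsSquare ⊆
        (Finset.range (Nat.sqrt T + 1)).image fun i => i * i := by
      intro t ht
      obtain ⟨h1, i, rfl⟩ := Finset.mem_filter.1 ht
      refine Finset.mem_image.2 ⟨i, Finset.mem_range.2 (Nat.lt_succ_of_le ?_), rfl⟩
      exact Nat.le_sqrt.2 (Finset.mem_range.1 h1).le
    have := (Finset.card_le_card this).trans Finset.card_image_le
    rw [Finset.card_range] at this
    exact_mod_cast this
  rw [Real.norm_of_nonneg (Finset.sum_nonneg fun t _ => by split_ifs <;> norm_num),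
    Real.norm_of_nonneg (Nat.cast_nonneg _)]
  have h1 : ((Nat.sqrt T : ℝ)) ^ 2 ≤ T := by exact_mod_cast Nat.sqrt_le' T
  have h2 : (n : ℝ) + 1 ≤ Nat.sqrt T := by exact_mod_cast hs
  have h3 : 2 ≤ c * Nat.sqrt T := by
    rw [div_lt_iff₀ hc] at hn
    nlinarith
  have h4 : (1 : ℝ) ≤ Nat.sqrt T := by linarith [n.cast_nonneg (α := ℝ)]
  nlinarith

theorem isLittleO_sum_range {u : ℕ → ℝ} (h : Tendsto u atTop (𝓝 0)) :
    (fun T : ℕ => ∑ t ∈ Finset.range T, u t) =o[atTop] fun T : ℕ => (T : ℝ) := by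
  rw [isLittleO_iff_tendsto' (by
    filter_upwards [eventually_ne_atTop 0] with T hT h0
    exact absurd (Nat.cast_eq_zero.1 h0) hT)]
  simpa [div_eq_inv_mul] using h.cesaro

/-! ### The explore-exploit rule -/

section ArgMax

theorem exists_argMax (N : ℕ) (v : ℕ → ℝ) : ∃ j, j ≤ N ∧ ∀ i ≤ N, v i ≤ v j := by
  obtain ⟨j, hj, hmax⟩ := Finset.exists_max_image (Finset.range (N + 1)) v ⟨0, by simp⟩
  exact ⟨j, Nat.lt_succ_iff.1 (Finset.mem_range.1 hj), fun i hi =>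
    hmax i (Finset.mem_range.2 (Nat.lt_succ_of_le hi))⟩

open Classical in
/-- The first of the indices `0, …, N` at which `v` is maximal. -/
noncomputable def argMax (N : ℕ) (v : ℕ → ℝ) : ℕ := Nat.find (exists_argMax N v)

open Classical in
theorem argMax_spec (N : ℕ) (v : ℕ → ℝ) : argMax N v ≤ N ∧ ∀ i ≤ N, v i ≤ v (argMax N v) :=
  Nat.find_spec (exists_argMax N v)

open Classical in
theorem measurable_argMax (N : ℕ) : Measurable (argMax N) := by
  refine measurable_find (exists_argMax N) fun j => ?_
  have : {v : ℕ → ℝ | j ≤ N ∧ ∀ i ≤ N, v i ≤ v j} =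
      {_v | j ≤ N} ∩ ⋂ i ∈ Set.Iic N, {v | v i ≤ v j} := by
    ext
    simp
  rw [this]
  refine (MeasurableSet.const _).inter (MeasurableSet.biInter (Set.to_countable _) fun i _ => ?_)
  exact measurableSet_le (measurable_pi_apply i) (measurable_pi_apply j)

end ArgMax

/-- The number of observations of each arm that are used at level `k`, when `N + 1` arms are
compared. -/
def sampleSize (N : ℕ → ℕ) (k : ℕ) : ℕ := ((k + 1) * (N k + 1)) ^ 2

/-- The average of the first `m` observations of arm `j`, from the payoffs `p`. The `l`-th
observation of arm `j` is made in round `(Nat.pair j l) ^ 2`. -/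
noncomputable def empiricalMean (m : ℕ) (p : ℕ → ℝ) (j : ℕ) : ℝ :=
  (∑ l ∈ Finset.range m, p (Nat.pair j l * Nat.pair j l)) / m

open Classical in
/-- Explore in the rounds whose number is a square, exploit in the others: `κ t` is the level of
precision in round `t`, and `N k + 1` arms are compared at level `k`. -/
noncomputable def exploreExploit (N κ : ℕ → ℕ) (t : ℕ) (p : ℕ → ℝ) : ℕ :=
  if IsSquare t then (Nat.unpair (Nat.sqrt t)).1
  else argMax (N (κ t)) (empiricalMean (sampleSize N (κ t)) p)

theorem measurable_exploreExploit (N κ : ℕ → ℕ) (t : ℕ) : Measurable (exploreExploit N κ t) := by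
  unfold exploreExploit
  split_ifs
  · exact measurable_const
  · refine (measurable_argMax _).comp (measurable_pi_lambda _ fun j => ?_)
    exact (Finset.measurable_fun_sum _ fun l _ =>
      measurable_pi_apply (Nat.pair j l * Nat.pair j l)).div_const _

/-- The exploration schedule ignores the payoffs, so samples of an arm come from deterministic
rounds and are independent without any conditioning. -/
theorem exploreExploit_pair (N κ : ℕ → ℕ) (j l : ℕ) (p : ℕ → ℝ) :
    exploreExploit N κ (Nat.pair j l * Nat.pair j l) p = j := by
  rw [exploreExploit, if_pos ⟨_, rfl⟩, Nat.sqrt_eq, Nat.unpair_pair]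

theorem pair_mul_self_injective (j : ℕ) :
    Function.Injective fun l => Nat.pair j l * Nat.pair j l := fun _ _ h =>
  (Nat.pair_eq_pair.1 (Nat.mul_self_inj.1 h)).2

/-! ### The upper bound for totally bounded spaces -/

section Tractable

/-- Initial segments of one dense sequence serve as nets at all scales: each centre of a finite
cover is replaced by a nearby term, half the radius being spent on either step. -/
theorem exists_finite_nets {X : Type u} [MetricSpace X] [Nonempty X]
    (h : TotallyBounded (Set.univ : Set X)) :
    ∃ (x : ℕ → X) (N : ℕ → ℕ), ∀ k y, ∃ j ≤ N k, dist y (x j) ≤ 1 / ((k : ℝ) + 1) := by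
  have : TopologicalSpace.SeparableSpace X :=
    TopologicalSpace.isSeparable_univ_iff.1 h.isSeparable
  have key : ∀ k : ℕ, ∃ n : ℕ, ∀ y, ∃ j ≤ n,
      dist y (TopologicalSpace.denseSeq X j) ≤ 1 / ((k : ℝ) + 1) := by
    intro k
    have hk : (0 : ℝ) < 1 / ((k : ℝ) + 1) / 2 := by positivity
    obtain ⟨s, hs, hcov⟩ := Metric.totallyBounded_iff.1 h _ hk
    choose J hJ using fun y : X =>
      Metric.denseRange_iff.1 (TopologicalSpace.denseRange_denseSeq X) y _ hk
    refine ⟨hs.toFinset.sup J, fun y => ?_⟩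
    obtain ⟨c, hc, hyc⟩ := Set.mem_iUnion₂.1 (hcov (Set.mem_univ y))
    refine ⟨J c, Finset.le_sup (hs.mem_toFinset.2 hc), ?_⟩
    have h1 := hJ c
    rw [Metric.mem_ball] at hyc
    linarith [dist_triangle y c (TopologicalSpace.denseSeq X (J c))]
  choose N hN using key
  exact ⟨_, N, hN⟩

variable {X : Type u}

/-- The explore-exploit algorithm on the arms `x 0, x 1, …`. -/
noncomputable abbrev exploreExploitAlgorithm [MeasurableSpace X] (x : ℕ → X) (N κ : ℕ → ℕ) : ExpertsAlgorithm X :=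
  ExpertsAlgorithm.ofChoice x (exploreExploit N κ) (measurable_exploreExploit N κ)

theorem exploreExploitAlgorithm_wellDefinedOn [MeasurableSpace X] (x : ℕ → X) (N κ : ℕ → ℕ)
    (P : Measure (Payoff X)) :
    (exploreExploitAlgorithm x N κ).WellDefinedOn P := fun t =>
  (ExpertsAlgorithm.ofChoice_measurable_strategy x _ _ t).aemeasurable

variable [MetricSpace X] [MeasurableSpace X]

/-- The expected gap in an exploitation round in which all required observations are available. -/
theorem integral_gap_exploit_le [BorelSpace X] (x : ℕ → X) {N κ : ℕ → ℕ}
    (hN : ∀ k y, ∃ j ≤ N k, dist y (x j) ≤ 1 / ((k : ℝ) + 1))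
    {P : Measure (Payoff X)} (hP : IsLipschitzInstance P) [Nonempty X] {t : ℕ} (ht : ¬ IsSquare t)
    (hready : ∀ j ≤ N (κ t), ∀ l < sampleSize N (κ t), Nat.pair j l * Nat.pair j l < t) :
    ∫ z, ((⨆ y, meanPayoff P y) - meanPayoff P ((exploreExploitAlgorithm x N κ).strategy t z))
      ∂((exploreExploitAlgorithm x N κ).sampleLaw P) ≤ 3 / ((κ t : ℝ) + 1) := by
  have hPp := hP.isProbabilityMeasure
  set A := exploreExploitAlgorithm x N κ
  set k := κ t
  set D := (k + 1) * (N k + 1) with hD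
  have hD0 : 0 < D := by positivity
  have hk0 : (0 : ℝ) < (k : ℝ) + 1 := by positivity
  set M := Measure.infinitePi fun _ : ℕ => P
  set e : ℕ → (ℕ → Payoff X) → ℝ := fun j f =>
    (∑ l ∈ Finset.range (D ^ 2), (f (Nat.pair j l * Nat.pair j l) (x j) : ℝ)) / ((D ^ 2 : ℕ) : ℝ) -
      meanPayoff P (x j) with he
  have hem : ∀ j, Measurable (e j) := fun j => measurable_average_sub P (x j) _ _
  have heb : ∀ j f, |e j f| ≤ 1 := fun j f => abs_average_sub_le_one P (x j) _ _ f
  have hei : ∀ j, Integrable (fun f => |e j f|) M := fun j =>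
    Integrable.of_mem_Icc 0 1 (hem j).abs.aemeasurable
      (Eventually.of_forall fun f => ⟨abs_nonneg _, heb j f⟩)
  -- The net costs `1 / (k + 1)`; comparing a near-optimal arm with the chosen one costs two
  -- estimation errors, each at most the sum of all errors.
  have hpt : ∀ z, (⨆ y, meanPayoff P y) - meanPayoff P (A.strategy t z) ≤
      1 / ((k : ℝ) + 1) + 2 * ∑ j ∈ Finset.range (N k + 1), |e j z.2| := by
    intro z
    set p := ExpertsAlgorithm.ofChoicePayoffs x (exploreExploit N κ)
      (measurable_exploreExploit N κ) t z with hp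
    set b := argMax (N k) (empiricalMean (sampleSize N k) p) with hb
    obtain ⟨hbN, hbmax⟩ := argMax_spec (N k) (empiricalMean (sampleSize N k) p)
    rw [← hb] at hbN hbmax
    have hstrat : A.strategy t z = x b := by
      rw [ExpertsAlgorithm.ofChoice_strategy, exploreExploit, if_neg ht]
    have hemp : ∀ j ≤ N k, empiricalMean (sampleSize N k) p j = e j z.2 + meanPayoff P (x j) := by
      intro j hj
      simp only [he, sub_add_cancel, empiricalMean, sampleSize]
      congr 1
      refine Finset.sum_congr rfl fun l hl => ?_
      rw [hp, ExpertsAlgorithm.ofChoicePayoffs_apply x _ _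
        (hready j hj l (Finset.mem_range.1 hl)), exploreExploit_pair]
    have hsingle : ∀ j ≤ N k, |e j z.2| ≤ ∑ j ∈ Finset.range (N k + 1), |e j z.2| := fun j hj =>
      Finset.single_le_sum (f := fun j => |e j z.2|) (fun _ _ => abs_nonneg _)
        (Finset.mem_range.2 (Nat.lt_succ_of_le hj))
    rw [hstrat, sub_le_iff_le_add]
    refine ciSup_le fun y => ?_
    obtain ⟨j, hj, hyj⟩ := hN k y
    have h1 : meanPayoff P y ≤ meanPayoff P (x j) + 1 / ((k : ℝ) + 1) := by
      have := hP.lipschitz.le_add_mul y (x j)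
      simp only [NNReal.coe_one, one_mul] at this
      linarith
    have h2 := hbmax j hj
    rw [hemp j hj, hemp b hbN] at h2
    linarith [neg_abs_le (e j z.2), le_abs_self (e b z.2), hsingle j hj, hsingle b hbN]
  have hsnd : MeasurePreserving Prod.snd (A.sampleLaw P) M := measurePreserving_snd
  have hsumi : Integrable (fun f => 1 / ((k : ℝ) + 1) +
      2 * ∑ j ∈ Finset.range (N k + 1), |e j f|) M :=
    (integrable_const _).add ((integrable_finsetSum _ fun j _ => hei j).const_mul 2)
  have hgapi : Integrable (fun z => (⨆ y, meanPayoff P y) - meanPayoff P (A.strategy t z))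
      (A.sampleLaw P) :=
    (integrable_const _).sub (Integrable.of_mem_Icc 0 1
      (hP.lipschitz.continuous.measurable.comp_aemeasurable
        (exploreExploitAlgorithm_wellDefinedOn x N κ P t))
      (Eventually.of_forall fun z => meanPayoff_mem_Icc _))
  calc _ ≤ ∫ z, (1 / ((k : ℝ) + 1) + 2 * ∑ j ∈ Finset.range (N k + 1), |e j z.2|)
        ∂(A.sampleLaw P) :=
        integral_mono hgapi (hsnd.integrable_comp_of_integrable hsumi) hpt
    _ = ∫ f, (1 / ((k : ℝ) + 1) + 2 * ∑ j ∈ Finset.range (N k + 1), |e j f|) ∂M := by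
        rw [← hsnd.map_eq, integral_map hsnd.measurable.aemeasurable
          (by rw [hsnd.map_eq]; exact hsumi.aestronglyMeasurable)]
    _ = 1 / ((k : ℝ) + 1) + 2 * ∑ j ∈ Finset.range (N k + 1), ∫ f, |e j f| ∂M := by
        rw [integral_add (integrable_const _)
          ((integrable_finsetSum _ fun j _ => hei j).const_mul 2), integral_const_mul,
          integral_finsetSum _ fun j _ => hei j]
        simp
    _ ≤ 1 / ((k : ℝ) + 1) + 2 * ∑ j ∈ Finset.range (N k + 1), 1 / (D : ℝ) := by
        gcongr with j
        exact integral_abs_average_sub_le P (x j) (pair_mul_self_injective j) hD0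
    _ = 3 / ((k : ℝ) + 1) := by
        rw [Finset.sum_const, Finset.card_range, nsmul_eq_mul, hD]
        push_cast
        field_simp
        norm_num

theorem integral_gap_le_one [Nonempty X] (A : ExpertsAlgorithm X) {P : Measure (Payoff X)}
    (hP : IsLipschitzInstance P) (t : ℕ) :
    ∫ z, ((⨆ y, meanPayoff P y) - meanPayoff P (A.strategy t z)) ∂(A.sampleLaw P) ≤ 1 := by
  have hPp := hP.isProbabilityMeasure
  have hsup : ⨆ y, meanPayoff P y ≤ 1 := ciSup_le fun y => (meanPayoff_mem_Icc y).2
  have : ∫ z, ((⨆ y, meanPayoff P y) - meanPayoff P (A.strategy t z)) ∂(A.sampleLaw P) ≤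
      ∫ _, (1 : ℝ) ∂(A.sampleLaw P) :=
    integral_mono_of_nonneg
      (Eventually.of_forall fun z => sub_nonneg.2 (le_ciSup (bddAbove_meanPayoff P) _))
      (integrable_const _)
      (Eventually.of_forall fun z => by
        have := (meanPayoff_mem_Icc (P := P) (A.strategy t z)).1
        simp only
        linarith)
  simpa using this

theorem exists_banditTractable_of_totallyBounded [BorelSpace X] [Nonempty X]
    (h : TotallyBounded (Set.univ : Set X)) :
    ∃ f : ℕ → ℝ, f =o[atTop] (fun t : ℕ => (t : ℝ)) ∧ BanditTractable X f := by
  classical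
  obtain ⟨x, N, hN⟩ := exists_finite_nets h
  set ready : ℕ → ℕ → Prop := fun k t =>
    ∀ j ≤ N k, ∀ l < sampleSize N k, Nat.pair j l * Nat.pair j l < t with hready
  obtain ⟨κ, hκ, hκr⟩ := exists_tendsto_forall_eventually (p := ready) fun k =>
    (eventually_all_finite (Set.finite_Iic (N k))).2 fun j _ =>
      (eventually_all_finite (Set.finite_Iio (sampleSize N k))).2 fun l _ =>
        eventually_gt_atTop _
  -- The trivial bound 1 covers the early rounds; neither `κ` nor `ρ` depends on the instance, so
  -- the constant 1 works for all of them.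
  set ρ : ℕ → ℝ := fun t => if ready (κ t) t then 3 / ((κ t : ℝ) + 1) else 1 with hρ
  have hρ0 : ∀ t, 0 ≤ ρ t := fun t => by simp only [hρ]; split_ifs <;> positivity
  have hρlim : Tendsto ρ atTop (𝓝 0) := by
    have h1 : Tendsto (fun k : ℕ => (3 : ℝ) / ((k : ℝ) + 1)) atTop (𝓝 0) :=
      tendsto_const_nhds.div_atTop
        (tendsto_atTop_add_const_right _ _ tendsto_natCast_atTop_atTop)
    refine (h1.comp hκ).congr' ?_
    filter_upwards [hκr] with t ht
    simp [hρ, ht]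
  refine ⟨fun T => ∑ t ∈ Finset.range T, ((if IsSquare t then (1 : ℝ) else 0) + ρ t), ?_,
    exploreExploitAlgorithm x N κ, ExpertsAlgorithm.ofChoice_usesBanditFeedback _ _ _,
    fun P hP => ⟨exploreExploitAlgorithm_wellDefinedOn x N κ P, 1, fun T => ?_⟩⟩
  · simp_rw [Finset.sum_add_distrib]
    exact isLittleO_sum_isSquare.add (isLittleO_sum_range hρlim)
  · rw [one_mul, ExpertsAlgorithm.regret_eq_sum _ hP
      (exploreExploitAlgorithm_wellDefinedOn x N κ P)]
    refine Finset.sum_le_sum fun t _ => ?_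
    have hle := integral_gap_le_one (exploreExploitAlgorithm x N κ) hP t
    by_cases hsq : IsSquare t
    · rw [if_pos hsq]
      linarith [hρ0 t]
    · rw [if_neg hsq, zero_add]
      by_cases hr : ready (κ t) t
      · simp only [hρ, if_pos hr]
        exact integral_gap_exploit_le x hN hP hsq hr
      · simpa only [hρ, if_neg hr] using hle

end Tractable

/-! ### The dichotomy -/

theorem BanditTractable.fullFeedbackTractable {X : Type u} [MetricSpace X] [MeasurableSpace X]
    {f : ℕ → ℝ} (h : BanditTractable X f) : FullFeedbackTractable X f := by
  obtain ⟨A, -, hA⟩ := h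
  exact ⟨A, fun P hP _ => (hA P hP).2⟩

/-- Total boundedness passes between `X` and its image in the completion; the closure of that image
is everything, and closed totally bounded sets in a complete space are compact. -/
theorem compactSpace_completion_iff {X : Type u} [MetricSpace X] :
    CompactSpace (UniformSpace.Completion X) ↔ TotallyBounded (Set.univ : Set X) := by
  have hui : IsUniformInducing ((↑) : X → UniformSpace.Completion X) :=
    UniformSpace.Completion.isUniformInducing_coe X
  rw [← totallyBounded_image_iff hui, Set.image_univ]
  constructor
  · intro h
    exact isCompact_univ.totallyBounded.subset (Set.subset_univ _)
  · intro h
    refine ⟨?_⟩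
    have := h.closure.isCompact_of_isClosed isClosed_closure
    rwa [UniformSpace.Completion.denseRange_coe.closure_range] at this

theorem mainTheorem5 {X : Type u} [MetricSpace X] [Nonempty X] [MeasurableSpace X] [BorelSpace X] :
    Xor (∃ f : ℕ → ℝ, f =o[atTop] (fun t : ℕ => (t : ℝ)) ∧ BanditTractable X f)
      (∀ g : ℕ → ℝ, g =o[atTop] (fun t : ℕ => (t : ℝ)) → ¬ FullFeedbackTractable X g) ∧
    ((∃ f : ℕ → ℝ, f =o[atTop] (fun t : ℕ => (t : ℝ)) ∧ BanditTractable X f) ↔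
      CompactSpace (UniformSpace.Completion X)) := by
  rw [compactSpace_completion_iff]
  have hexcl : (∃ f : ℕ → ℝ, f =o[atTop] (fun t : ℕ => (t : ℝ)) ∧ BanditTractable X f) →
      ¬ ∀ g : ℕ → ℝ, g =o[atTop] (fun t : ℕ => (t : ℝ)) → ¬ FullFeedbackTractable X g :=
    fun ⟨f, hf, hft⟩ hall => hall f hf hft.fullFeedbackTractable
  by_cases h : TotallyBounded (Set.univ : Set X)
  · have hb := exists_banditTractable_of_totallyBounded h
    exact ⟨Or.inl ⟨hb, hexcl hb⟩, iff_of_true hb h⟩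
  · have hn : ∀ g : ℕ → ℝ, g =o[atTop] (fun t : ℕ => (t : ℝ)) → ¬ FullFeedbackTractable X g :=
      fun g hg => not_fullFeedbackTractable_of_not_totallyBounded h hg
    have hb := fun hb => hexcl hb hn
    exact ⟨Or.inr ⟨hn, hb⟩, iff_of_false hb h⟩
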